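/- Let $m,n,k$ be integers with $1 \le k < \min\{m,n\}$, and identify $M_m\otimes M_n$ (complex matrices) with the linear operators on $\mathbb C^m\otimes\mathbb C^n$. The Schmidt rank $SR(v)$ of $v\in\mathbb C^m\otimes\mathbb C^n$ is the least integer $r$ such that $v$ is a linear combination of $r$ vectors of the form $a\otimes b$ with $a\in\mathbb C^m$, $b\in\mathbb C^n$ unit vectors. For $X\in M_m\otimes M_n$ put $$\|X\|_{S(k)}=\sup\{|v^\dagger Xw|:\ \|v\|=\|w\|=1,\ SR(v),SR(w)\le k\},$$ $$\|X\|_{\gamma,k}=\inf\Big\{\sum_i|c_i|:\ X=\sum_i c_i\,v_iw_i^\dagger\Big\},$$ where the infimum is over all finite decompositions with $c_i\in\mathbb C$ and unit vectors $v_i,w_i\in\mathbb C^m\otimes\mathbb C^n$ satisfying $SR(v_i),SR(w_i)\le k$. Let $\mathcal U$ be the set of matrices $U\in M_m\otimes M_n$ such that $U=U_1\otimes U_2$, or $n=m$ and $U=S(U_1\otimes U_2)$, where $U_1\in M_m$ and $U_2\in M_n$ are unitary and $S$ is the swap operator $S(a\otimes b)=b\otimes a$. Let $\Phi:M_m\otimes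 M_n\to M_m\otimes M_n$ be a (complex-)linear map. Then the following are equivalent: (a) $\|\Phi(X)\|_{S(k)}=\|X\|_{S(k)}$ for all $X\in M_m\otimes M_n$; (b) $\|\Phi(X)\|_{\gamma,k}=\|X\|_{\gamma,k}$ for all $X\in M_m\otimes M_n$; (c) $\Phi$ is a composition of one or more maps, each of which is of one of the following kinds: $X\mapsto UXV$ with $U,V\in\mathcal U$; the transpose map $X\mapsto X^T$ (with respect to the standard product basis); and, if $k=1$, the partial transpose $\mathrm{id}_m\otimes T$, where $T$ is the transpose map on $M_n$. -/

import Mathlib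

open scoped Matrix Kronecker

noncomputable section

namespace EntNorm

/-- `ℂ^m ⊗ ℂ^n` with its Hilbert space norm, in the product basis `e_i ⊗ e_j`. -/
abbrev Vec (m n : ℕ) : Type := EuclideanSpace ℂ (Fin m × Fin n)

/-- `M_m ⊗ M_n`, in the product basis; `A ⊗ B` is the Kronecker product `A ⊗ₖ B`. -/
abbrev Op (m n : ℕ) : Type := Matrix (Fin m × Fin n) (Fin m × Fin n) ℂ

/-- The elementary tensor `a ⊗ b`. -/
def tensorVec {m n : ℕ} (a : EuclideanSpace ℂ (Fin m)) (b : EuclideanSpace ℂ (Fin n)) :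
    Vec m n :=
  WithLp.toLp 2 fun p => a p.1 * b p.2

/-- A separable pure state: an elementary tensor of two unit vectors. -/
def IsSeparable {m n : ℕ} (v : Vec m n) : Prop :=
  ∃ (a : EuclideanSpace ℂ (Fin m)) (b : EuclideanSpace ℂ (Fin n)),
    ‖a‖ = 1 ∧ ‖b‖ = 1 ∧ v = tensorVec a b

/-- The Schmidt rank: the least number of separable pure states of which `v` is a linear
combination. -/
def schmidtRank {m n : ℕ} (v : Vec m n) : ℕ :=
  sInf {r : ℕ | ∃ (c : Fin r → ℂ) (u : Fin r → Vec m n),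
    (∀ i, IsSeparable (u i)) ∧ v = ∑ i, c i • u i}

/-- Unit vectors of Schmidt rank at most `k`. -/
def IsPureState {m n : ℕ} (k : ℕ) (v : Vec m n) : Prop :=
  ‖v‖ = 1 ∧ schmidtRank v ≤ k

/-- The `S(k)`-norm: the supremum of `|⟨v|X|w⟩|` over unit vectors of Schmidt rank at most `k`. -/
def skNorm {m n : ℕ} (k : ℕ) (X : Op m n) : ℝ :=
  sSup {r : ℝ | ∃ v w : Vec m n, IsPureState k v ∧ IsPureState k w ∧
    r = ‖star v.ofLp ⬝ᵥ (X *ᵥ w.ofLp)‖}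

/-- The norm `‖·‖_{γ,k}`: the infimum of `∑ |c_i|` over the finite decompositions
`X = ∑ c_i |v_i⟩⟨w_i|` with unit vectors `v_i`, `w_i` of Schmidt rank at most `k`. -/
def gammaNorm {m n : ℕ} (k : ℕ) (X : Op m n) : ℝ :=
  sInf {r : ℝ | ∃ (N : ℕ) (c : Fin N → ℂ) (v w : Fin N → Vec m n),
    (∀ i, IsPureState k (v i)) ∧ (∀ i, IsPureState k (w i)) ∧
    X = ∑ i, c i • Matrix.vecMulVec (v i).ofLp (star (w i).ofLp) ∧
    r = ∑ i, ‖c i‖}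

/-- The swap operator, `S (a ⊗ b) = b ⊗ a`, when the two factors have the same dimension. -/
def swapOp {m n : ℕ} (h : n = m) : Op m n :=
  Matrix.of fun p q => if p = (Fin.cast h q.2, Fin.cast h.symm q.1) then 1 else 0

/-- Matrices of the form `U₁ ⊗ U₂`, or (if `n = m`) `S (U₁ ⊗ U₂)`, with `U₁`, `U₂` unitary. -/
def IsLocalUnitary {m n : ℕ} (U : Op m n) : Prop :=
  ∃ U₁ ∈ Matrix.unitaryGroup (Fin m) ℂ, ∃ U₂ ∈ Matrix.unitaryGroup (Fin n) ℂ,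
    U = U₁ ⊗ₖ U₂ ∨ ∃ h : n = m, U = swapOp h * (U₁ ⊗ₖ U₂)

/-- The partial transpose `id_m ⊗ T`. -/
def partialTranspose {m n : ℕ} (X : Op m n) : Op m n :=
  Matrix.of fun p q => X (p.1, q.2) (q.1, p.2)

/-- The three kinds of maps from which the isometries are composed. -/
def generators (m n k : ℕ) : Set (Module.End ℂ (Op m n)) :=
  {Φ | (∃ U V : Op m n, IsLocalUnitary U ∧ IsLocalUnitary V ∧ ∀ X, Φ X = U * X * V) ∨
    (∀ X, Φ X = Xᵀ) ∨
    (k = 1 ∧ ∀ X, Φ X = partialTranspose X)}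

end EntNorm

end

/-
Let `S` be the compact set of operators `|v⟩⟨w|` with `v`, `w` pure states of Schmidt rank at most
`k`. The `S(k)`-norm is the support function of `S`, and the `γ`-norm is the gauge of its convex
hull. By duality, the isometries of the `γ`-norm are the maps `Φ` with `Φ(S) = S`, and those of the
`S(k)`-norm are their adjoints.

A map with `Φ(S) = S` preserves the class of operators `v wᵀ` with `v`, `w` of tensor rank at most
`k`. Among these, the ones with `v`, `w` of tensor rank one are characterized linearly: `Z` is such
an operator if and only if `Y + c Z` stays in the class whenever `Y` and `Y + Z` belong to it. So
`Φ` preserves the elementary tensors of `ℂ^m ⊗ ℂ^n ⊗ ℂ^m ⊗ ℂ^n`; hence it permutes the four factors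
and acts linearly on each of them. Composing with swaps and the transpose reduces the permutation to
the identity or the partial transpose, and the latter is impossible for `k ≥ 2`. In the case of the
identity, the actions on the factors are multiples of unitaries, because `Φ` preserves the
Hilbert–Schmidt norm of elementary tensors.
-/

noncomputable section

namespace EntNorm

section Hamming

variable {ι : Type*} {X Y : ι → Type*}

/-- The points `x` and `y` of a product differ at most in their `j`-th coordinate. -/
def AgreeOff (j : ι) (x y : ∀ i, Y i) : Prop :=
  ∀ l, l ≠ j → x l = y l

theorem AgreeOff.symm {j : ι} {x y : ∀ i, Y i} (h : AgreeOff j x y) : AgreeOff j y x :=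
  fun l hl => (h l hl).symm

theorem AgreeOff.apply_ne {j : ι} {x y : ∀ i, Y i} (h : AgreeOff j x y) (hne : x ≠ y) :
    x j ≠ y j := fun hj =>
  hne (funext fun l => by rcases eq_or_ne l j with rfl | hl <;> [exact hj; exact h l hl])

theorem AgreeOff.eq_of_triangle {j l t : ι} {x y z : ∀ i, Y i} (hxy : AgreeOff j y x)
    (hxz : AgreeOff l z x) (hyz : AgreeOff t z y) (hne : y ≠ x) (hne' : z ≠ x) : j = l := by
  have hj := hxy.apply_ne hne
  have hl := hxz.apply_ne hne'
  grind [AgreeOff]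

theorem AgreeOff.eq_of_square {j j' l l' : ι} {x y z w : ∀ i, Y i} (hxy : AgreeOff j y x)
    (hzw : AgreeOff j' w z) (hxz : AgreeOff l z x) (hyw : AgreeOff l' w y) (hne : y ≠ x)
    (hne' : w ≠ z) (hxw : x ≠ w) (hyz : y ≠ z) : j = j' := by
  have hj := hxy.apply_ne hne
  have hj' := hzw.apply_ne hne'
  obtain ⟨r, hr⟩ := Function.ne_iff.1 hxw
  obtain ⟨s, hs⟩ := Function.ne_iff.1 hyz
  by_contra h
  have hl : l = j ∨ l' = j := by
    by_contra!
    grind [AgreeOff]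
  have hl' : l = j' ∨ l' = j' := by
    by_contra!
    grind [AgreeOff]
  by_cases r = j <;> by_cases s = j <;> grind [AgreeOff]

variable [DecidableEq ι]

/-- The map `φ` sends points that differ in one coordinate to points that differ in at most one
coordinate. -/
def PreservesAdjacency (φ : (∀ i, X i) → ∀ j, Y j) : Prop :=
  ∀ x i a, ∃ j, AgreeOff j (φ (Function.update x i a)) (φ x)

/-- Moving the `i`-th coordinate of `x` moves only the `j`-th coordinate of `φ x`. -/
def MovesOnly (φ : (∀ i, X i) → ∀ j, Y j) (x : ∀ i, X i) (i j : ι) : Prop :=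
  ∀ a, AgreeOff j (φ (Function.update x i a)) (φ x)

variable {φ : (∀ i, X i) → ∀ j, Y j}

theorem PreservesAdjacency.exists_movesOnly (hφ : PreservesAdjacency φ)
    (hinj : Function.Injective φ) (x : ∀ i, X i) (i : ι) : ∃ j, MovesOnly φ x i j := by
  by_cases h : ∃ a, a ≠ x i
  · obtain ⟨a, ha⟩ := h
    obtain ⟨j, hj⟩ := hφ x i a
    refine ⟨j, fun b => ?_⟩
    rcases eq_or_ne b (x i) with rfl | hb
    · simp [AgreeOff]
    obtain ⟨l, hl⟩ := hφ x i b
    obtain ⟨t, ht⟩ := hφ (Function.update x i a) i b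
    rw [Function.update_idem] at ht
    rwa [AgreeOff.eq_of_triangle hj hl ht (hinj.ne (by simpa using ha))
      (hinj.ne (by simpa using hb))]
  · push Not at h
    exact ⟨i, fun a l _ => by rw [h a, Function.update_eq_self]⟩

theorem MovesOnly.update_of_ne (hφ : PreservesAdjacency φ) (hinj : Function.Injective φ)
    {x : ∀ i, X i} {i j i' : ι} (h : MovesOnly φ x i j) (hi : i' ≠ i) (b : X i') :
    MovesOnly φ (Function.update x i' b) i j := by
  intro a
  rcases eq_or_ne b (x i') with rfl | _
  · simpa using h a
  rcases eq_or_ne a (x i) with rfl | ha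
  · rw [Function.update_comm hi, Function.update_eq_self]
    exact fun _ _ => rfl
  obtain ⟨j', hj'⟩ := hφ (Function.update x i' b) i a
  obtain ⟨l, hl⟩ := hφ x i' b
  obtain ⟨l', hl'⟩ := hφ (Function.update x i a) i' b
  rw [Function.update_comm hi.symm] at hl'
  suffices j = j' by rwa [this]
  refine AgreeOff.eq_of_square (h a) hj' hl hl' (hinj.ne ?_) (hinj.ne ?_) (hinj.ne ?_)
    (hinj.ne ?_) <;> intro e <;> have := congrFun e i <;> grind [Function.update]

theorem MovesOnly.of_point [Finite ι] (hφ : PreservesAdjacency φ) (hinj : Function.Injective φ)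
    {x : ∀ i, X i} {i j : ι} (h : MovesOnly φ x i j) (y : ∀ i, X i) : MovesOnly φ y i j := by
  have := Fintype.ofFinite ι
  suffices ∀ s : Finset ι, MovesOnly φ (s.piecewise y x) i j by
    simpa using this Finset.univ
  intro s
  induction s using Finset.induction_on with
  | empty => simpa using h
  | insert r s _ ih =>
    rw [Finset.piecewise_insert]
    rcases eq_or_ne r i with rfl | hr
    · intro a l hl
      rw [Function.update_idem, ih a l hl, ih _ l hl]
    · exact ih.update_of_ne hφ hinj hr _

theorem apply_congr_of_movesOnly [Finite ι] {σ : ι → ι} (hσ : ∀ x i, MovesOnly φ x i (σ i))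
    {x y : ∀ i, X i} {j : ι} (h : ∀ i, σ i = j → x i = y i) : φ x j = φ y j := by
  have := Fintype.ofFinite ι
  suffices ∀ s : Finset ι, φ (s.piecewise y x) j = φ x j by
    simpa using (this Finset.univ).symm
  intro s
  induction s using Finset.induction_on with
  | empty => simp
  | insert r s hr ih =>
    rw [Finset.piecewise_insert]
    rcases eq_or_ne (σ r) j with hj | hj
    · rw [← h r hj, ← Finset.piecewise_eq_of_notMem s y x hr, Function.update_eq_self, ih]
    · rw [hσ _ r _ j hj.symm, ih]

theorem surjective_of_movesOnly [Finite ι] [∀ i, Nonempty (X i)] [∀ i, Nontrivial (Y i)]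
    (hsurj : Function.Surjective φ) {σ : ι → ι} (hσ : ∀ x i, MovesOnly φ x i (σ i)) :
    Function.Surjective σ := by
  intro j
  by_contra! hj
  let x₀ : ∀ i, X i := fun i => Classical.arbitrary _
  obtain ⟨p, hp⟩ := exists_ne (φ x₀ j)
  obtain ⟨x, hx⟩ := hsurj (Function.update (φ x₀) j p)
  have : φ x j = φ x₀ j := apply_congr_of_movesOnly hσ fun i hi => absurd hi (hj i)
  rw [hx, Function.update_self] at this
  exact hp this

theorem PreservesAdjacency.exists_perm [Finite ι] [∀ i, Nonempty (X i)] [∀ i, Nontrivial (Y i)]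
    (hφ : PreservesAdjacency φ) (hbij : Function.Bijective φ) :
    ∃ ρ : Equiv.Perm ι, ∀ x y j, x (ρ j) = y (ρ j) → φ x j = φ y j := by
  choose σ hσ using fun i => hφ.exists_movesOnly hbij.1 (fun i => Classical.arbitrary _) i
  have hσ' : ∀ x i, MovesOnly φ x i (σ i) := fun x i => (hσ i).of_point hφ hbij.1 x
  have hbijσ := Finite.surjective_iff_bijective.1 (surjective_of_movesOnly hbij.2 hσ')
  refine ⟨(Equiv.ofBijective σ hbijσ).symm, fun x y j h => apply_congr_of_movesOnly hσ' ?_⟩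
  rintro i rfl
  exact Equiv.ofBijective_symm_apply_apply σ hbijσ i ▸ h

end Hamming

section ProductTensor

open Projectivization LinearAlgebra.Projectivization

variable {K : Type*} [Field K]

theorem exists_eq_smul_of_minors {α : Type*} {p q : α → K} (hp : p ≠ 0)
    (h : ∀ s t, p s * q t = p t * q s) : ∃ c : K, q = c • p := by
  obtain ⟨s, hs⟩ := Function.ne_iff.1 hp
  rw [Pi.zero_apply] at hs
  refine ⟨q s / p s, funext fun t => ?_⟩
  rw [Pi.smul_apply, smul_eq_mul]
  field_simp
  linear_combination h s t

variable {ι : Type*} {κ : ι → Type*}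

theorem exists_eq_mk (p : ∀ i, ℙ K (κ i → K)) :
    ∃ (x : ∀ i, κ i → K) (hx : ∀ i, x i ≠ 0), p = fun i => mk K (x i) (hx i) :=
  ⟨fun i => (p i).rep, fun i => (p i).rep_nonzero, funext fun i => (mk_rep (p i)).symm⟩

theorem forall_update_ne_zero [DecidableEq ι] {x : ∀ i, κ i → K} (hx : ∀ i, x i ≠ 0) {i : ι}
    {v : κ i → K} (hv : v ≠ 0) : ∀ r, Function.update x i v r ≠ 0 :=
  (Function.forall_update_iff x fun _ w => w ≠ 0).2 ⟨hv, fun r _ => hx r⟩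

theorem update_mk [DecidableEq ι] {x : ∀ i, κ i → K} (hx : ∀ i, x i ≠ 0) {i : ι} {v : κ i → K}
    (hv : v ≠ 0) :
    Function.update (fun r => mk K (x r) (hx r)) i (mk K v hv) =
      fun r => mk K (Function.update x i v r) (forall_update_ne_zero hx hv r) := by
  funext r
  rcases eq_or_ne r i with rfl | hr
  · simp
  · simp [hr]

variable [Fintype ι]

/-- The elementary tensor `⨂ i, x i`, as a function of the multi-indices. -/
def prodTensor : MultilinearMap K (fun i => κ i → K) ((∀ i, κ i) → K) :=
  MultilinearMap.pi fun J =>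
    (MultilinearMap.mkPiAlgebra K ι K).compLinearMap fun i => LinearMap.proj (J i)

theorem prodTensor_apply (x : ∀ i, κ i → K) (J : ∀ i, κ i) :
    prodTensor x J = ∏ i, x i (J i) := by
  simp [prodTensor]

theorem prodTensor_ne_zero_iff {x : ∀ i, κ i → K} : prodTensor x ≠ 0 ↔ ∀ i, x i ≠ 0 := by
  refine ⟨fun h i hi => h (prodTensor.map_coord_zero i hi), fun h => ?_⟩
  choose J hJ using fun i => Function.ne_iff.1 (h i)
  refine Function.ne_iff.2 ⟨J, ?_⟩
  rw [prodTensor_apply]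
  exact Finset.prod_ne_zero_iff.2 fun i _ => hJ i

theorem exists_ne_zero_of_prodTensor_ne_zero {x : ∀ i, κ i → K} (h : prodTensor x ≠ 0) :
    ∃ J : ∀ i, κ i, ∀ i, x i (J i) ≠ 0 := by
  obtain ⟨J, hJ⟩ := Function.ne_iff.1 h
  rw [prodTensor_apply, Pi.zero_apply, Finset.prod_ne_zero_iff] at hJ
  exact ⟨J, fun i => hJ i (Finset.mem_univ i)⟩

theorem prodTensor_single_one [∀ i, DecidableEq (κ i)] (J : ∀ i, κ i) :
    prodTensor (fun i => (Pi.single (J i) 1 : κ i → K)) = Pi.single J 1 := by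
  funext I
  rw [prodTensor_apply]
  rcases eq_or_ne I J with rfl | h
  · simp
  · obtain ⟨i, hi⟩ := Function.ne_iff.1 h
    rw [Pi.single_eq_of_ne h, Finset.prod_eq_zero (Finset.mem_univ i) (by simp [hi])]

/-- The Segre embedding: the projective point of the elementary tensor with the given factors. -/
def segre (p : ∀ i, ℙ K (κ i → K)) : ℙ K ((∀ i, κ i) → K) :=
  mk K (prodTensor fun i => (p i).rep) (prodTensor_ne_zero_iff.2 fun i => (p i).rep_nonzero)

theorem segre_mk {x : ∀ i, κ i → K} (hx : ∀ i, x i ≠ 0) :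
    segre (fun i => mk K (x i) (hx i)) = mk K (prodTensor x) (prodTensor_ne_zero_iff.2 hx) := by
  choose a ha using fun i => exists_smul_eq_mk_rep K (x i) (hx i)
  refine (mk_eq_mk_iff' K _ _ _ _).2 ⟨∏ i, (a i : K), ?_⟩
  rw [← MultilinearMap.map_smul_univ]
  exact congrArg prodTensor (funext ha)

theorem prodTensor_apply_update [DecidableEq ι] (x : ∀ i, κ i → K) (J : ∀ i, κ i) (i : ι)
    (t : κ i) :
    prodTensor x (Function.update J i t) = x i t * ∏ r ∈ Finset.univ.erase i, x r (J r) := by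
  rw [prodTensor_apply, ← Finset.mul_prod_erase _ _ (Finset.mem_univ i), Function.update_self]
  congr 1
  exact Finset.prod_congr rfl fun r hr => by rw [Function.update_of_ne (Finset.ne_of_mem_erase hr)]

theorem prodTensor_update_one_apply [DecidableEq ι] (x : ∀ i, κ i → K) (J : ∀ i, κ i) (i : ι) :
    prodTensor (Function.update x i 1) J = ∏ r ∈ Finset.univ.erase i, x r (J r) := by
  rw [← Function.update_eq_self i J, prodTensor_apply_update, Function.update_self, Pi.one_apply,
    one_mul, Function.update_eq_self]
  exact Finset.prod_congr rfl fun r hr => by rw [Function.update_of_ne (Finset.ne_of_mem_erase hr)]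

theorem exists_eq_smul_of_prodTensor_eq_smul {x y : ∀ i, κ i → K} {c : K}
    (hx : ∀ i, x i ≠ 0) (h : prodTensor x = c • prodTensor y) (i : ι) : ∃ a : K, x i = a • y i := by
  classical
  obtain ⟨J, hJ⟩ := exists_ne_zero_of_prodTensor_ne_zero (prodTensor_ne_zero_iff.2 hx)
  have hP : ∏ r ∈ Finset.univ.erase i, x r (J r) ≠ 0 := Finset.prod_ne_zero_iff.2 fun r _ => hJ r
  refine ⟨c * (∏ r ∈ Finset.univ.erase i, y r (J r)) / ∏ r ∈ Finset.univ.erase i, x r (J r),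
    funext fun t => ?_⟩
  have := congrFun h (Function.update J i t)
  simp only [Pi.smul_apply, smul_eq_mul, prodTensor_apply_update] at this ⊢
  field_simp
  linear_combination this

theorem exists_eq_smul_of_prodTensor_add_eq {x y z : ∀ i, κ i → K} (hx : ∀ i, x i ≠ 0)
    (hy : ∀ i, y i ≠ 0) (hsum : prodTensor x + prodTensor y = prodTensor z) {i : ι}
    (hi : ¬ ∃ a : K, y i = a • x i) {l : ι} (hl : l ≠ i) : ∃ a : K, y l = a • x l := by
  classical
  obtain ⟨s, t, hst⟩ : ∃ s t, x i s * y i t ≠ x i t * y i s := by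
    by_contra! h
    exact hi (exists_eq_smul_of_minors (hx i) h)
  have one_ne_zero : (1 : κ i → K) ≠ 0 := Function.ne_iff.2 ⟨s, one_ne_zero⟩
  -- Flattened along `i`, the sum has rank one, so its `2 × 2` minors vanish; by Cauchy–Binet each
  -- of them is a minor of `(x i, y i)` times a minor of the products of the remaining factors.
  have minor : ∀ J J', prodTensor (Function.update x i 1) J * prodTensor (Function.update y i 1) J'
      = prodTensor (Function.update x i 1) J' * prodTensor (Function.update y i 1) J := by
    intro J J'
    have entry : ∀ r J, x i r * prodTensor (Function.update x i 1) J +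
        y i r * prodTensor (Function.update y i 1) J =
          z i r * prodTensor (Function.update z i 1) J := fun r J => by
      simpa only [prodTensor_update_one_apply, Pi.add_apply, prodTensor_apply_update] using
        congrFun hsum (Function.update J i r)
    have entries := congrArg₂ (· - ·) (congrArg₂ (· * ·) (entry s J) (entry t J'))
      (congrArg₂ (· * ·) (entry s J') (entry t J))
    refine mul_left_cancel₀ (sub_ne_zero.2 hst) ?_
    linear_combination entries
  obtain ⟨c, hc⟩ :=
    exists_eq_smul_of_minors (prodTensor_ne_zero_iff.2 (forall_update_ne_zero hx one_ne_zero)) minor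
  simpa only [Function.update_of_ne hl] using
    exists_eq_smul_of_prodTensor_eq_smul (forall_update_ne_zero hy one_ne_zero) hc l

theorem segre_injective :
    Function.Injective (segre : (∀ i, ℙ K (κ i → K)) → ℙ K ((∀ i, κ i) → K)) := by
  intro p q h
  obtain ⟨x, hx, rfl⟩ := exists_eq_mk p
  obtain ⟨y, hy, rfl⟩ := exists_eq_mk q
  rw [segre_mk, segre_mk] at h
  obtain ⟨c, hc⟩ := (mk_eq_mk_iff' K _ _ _ _).1 h
  funext i
  obtain ⟨a, ha⟩ := exists_eq_smul_of_prodTensor_eq_smul hx hc.symm i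
  exact (mk_eq_mk_iff' K _ _ _ _).2 ⟨a, ha.symm⟩

end ProductTensor

section ElementaryPreserver

open Projectivization LinearAlgebra.Projectivization

variable {K : Type*} [Field K] {ι : Type*} [Fintype ι] {κ : ι → Type*}

theorem ne_zero_of_map_prodTensor_eq {Φ : ((∀ i, κ i) → K) ≃ₗ[K] ((∀ i, κ i) → K)}
    {x y : ∀ i, κ i → K} (hx : ∀ i, x i ≠ 0) (h : Φ (prodTensor x) = prodTensor y) (i : ι) :
    y i ≠ 0 := by
  refine prodTensor_ne_zero_iff.1 ?_ i
  rw [← h]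
  exact Φ.map_ne_zero_iff.2 (prodTensor_ne_zero_iff.2 hx)

/-- The linear bijection `Φ` and its inverse map elementary tensors to elementary tensors. -/
def PreservesElementary (Φ : ((∀ i, κ i) → K) ≃ₗ[K] ((∀ i, κ i) → K)) : Prop :=
  ∀ T, Φ T ∈ Set.range (prodTensor : (∀ i, κ i → K) → _) ↔
    T ∈ Set.range (prodTensor : (∀ i, κ i → K) → _)

/-- The map `φ` of multiprojective points is the one that `Φ` induces through the Segre
embedding. -/
def IsInducedBy (φ : (∀ i, ℙ K (κ i → K)) → ∀ i, ℙ K (κ i → K))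
    (Φ : ((∀ i, κ i) → K) ≃ₗ[K] ((∀ i, κ i) → K)) : Prop :=
  ∀ (x y : ∀ i, κ i → K) (hx : ∀ i, x i ≠ 0) (hy : ∀ i, y i ≠ 0),
    Φ (prodTensor x) = prodTensor y → φ (fun i => mk K (x i) (hx i)) = fun i => mk K (y i) (hy i)

variable {Φ : ((∀ i, κ i) → K) ≃ₗ[K] ((∀ i, κ i) → K)}
  {φ : (∀ i, ℙ K (κ i → K)) → ∀ i, ℙ K (κ i → K)}

theorem PreservesElementary.exists_map (hΦ : PreservesElementary Φ) (x : ∀ i, κ i → K) :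
    ∃ y, Φ (prodTensor x) = prodTensor y :=
  let ⟨y, hy⟩ := (hΦ (prodTensor x)).2 ⟨x, rfl⟩
  ⟨y, hy.symm⟩

theorem PreservesElementary.exists_isInducedBy (hΦ : PreservesElementary Φ) :
    ∃ φ, IsInducedBy φ Φ ∧ Function.Bijective φ := by
  have exists_image : ∀ p : ∀ i, ℙ K (κ i → K),
      ∃ q, segre q = map Φ.toLinearMap Φ.injective (segre p) := fun p => by
    obtain ⟨x, hx, rfl⟩ := exists_eq_mk p
    obtain ⟨y, hy⟩ := hΦ.exists_map x
    refine ⟨fun i => mk K (y i) (ne_zero_of_map_prodTensor_eq hx hy i), ?_⟩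
    simp only [segre_mk, map_mk, LinearEquiv.coe_coe, hy]
  choose φ hφ using exists_image
  have induced : IsInducedBy φ Φ := fun x y hx hy h => segre_injective <| by
    simp only [hφ, segre_mk, map_mk, LinearEquiv.coe_coe, h]
  refine ⟨φ, induced, fun p q h => ?_, fun q => ?_⟩
  · refine segre_injective (map_injective _ Φ.injective ?_)
    rw [← hφ, ← hφ, h]
  · obtain ⟨y, hy, rfl⟩ := exists_eq_mk q
    obtain ⟨x, hx⟩ := (hΦ (Φ.symm (prodTensor y))).1 ⟨y, (Φ.apply_symm_apply _).symm⟩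
    have hxy : Φ (prodTensor x) = prodTensor y := by rw [hx, Φ.apply_symm_apply]
    have hx0 : ∀ i, x i ≠ 0 := prodTensor_ne_zero_iff.1 <| by
      rw [hx]
      exact Φ.symm.map_ne_zero_iff.2 (prodTensor_ne_zero_iff.2 hy)
    exact ⟨_, induced x y hx0 hy hxy⟩

theorem IsInducedBy.preservesAdjacency [DecidableEq ι] (hφ : IsInducedBy φ Φ)
    (hΦ : PreservesElementary Φ) : PreservesAdjacency φ := by
  intro p i q
  obtain ⟨x, hx, rfl⟩ := exists_eq_mk p
  induction q using Projectivization.ind with | h v hv => ?_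
  obtain ⟨y, hy⟩ := hΦ.exists_map x
  obtain ⟨z, hz⟩ := hΦ.exists_map (Function.update x i v)
  obtain ⟨w, hw⟩ := hΦ.exists_map (Function.update x i (x i + v))
  have hy0 := ne_zero_of_map_prodTensor_eq hx hy
  have hz0 := ne_zero_of_map_prodTensor_eq (forall_update_ne_zero hx hv) hz
  rw [update_mk hx hv, hφ x y hx hy0 hy, hφ _ z _ hz0 hz]
  have hsum : prodTensor y + prodTensor z = prodTensor w := by
    rw [← hy, ← hz, ← hw, MultilinearMap.map_update_add, map_add, Function.update_eq_self]
  by_cases h : ∃ j, ¬ ∃ a : K, z j = a • y j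
  · obtain ⟨j, hj⟩ := h
    refine ⟨j, fun l hl => ?_⟩
    obtain ⟨a, ha⟩ := exists_eq_smul_of_prodTensor_add_eq hy0 hz0 hsum hj hl
    exact (mk_eq_mk_iff' K _ _ _ _).2 ⟨a, ha.symm⟩
  · push Not at h
    refine ⟨i, fun l _ => ?_⟩
    obtain ⟨a, ha⟩ := h l
    exact (mk_eq_mk_iff' K _ _ _ _).2 ⟨a, ha.symm⟩

theorem nontrivial_projectivization_pi {κ : Type*} [Nontrivial κ] : Nontrivial (ℙ K (κ → K)) := by
  classical
  obtain ⟨s, t, hst⟩ := exists_pair_ne κ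
  refine ⟨mk K (Pi.single s 1) (by simp), mk K (Pi.single t 1) (by simp), fun h => ?_⟩
  obtain ⟨a, ha⟩ := (mk_eq_mk_iff' K _ _ _ _).1 h
  simpa [hst] using congrFun ha s

/-- In the images of elementary tensors under `Φ`, the `j`-th factor depends, up to a scalar, only
on the `ρ j`-th factor of the argument. -/
def FactorsAlong (Φ : ((∀ i, κ i) → K) ≃ₗ[K] ((∀ i, κ i) → K)) (ρ : ι → ι) : Prop :=
  ∀ x x' y y' : ∀ i, κ i → K, (∀ i, x i ≠ 0) → (∀ i, x' i ≠ 0) →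
    Φ (prodTensor x) = prodTensor y → Φ (prodTensor x') = prodTensor y' →
    ∀ j, x (ρ j) = x' (ρ j) → ∃ a : K, y j = a • y' j

theorem PreservesElementary.exists_factorsAlong [∀ i, Nontrivial (κ i)]
    (hΦ : PreservesElementary Φ) : ∃ ρ : Equiv.Perm ι, FactorsAlong Φ ρ := by
  classical
  obtain ⟨φ, hφ, hbij⟩ := hΦ.exists_isInducedBy
  have : ∀ i, Nontrivial (ℙ K (κ i → K)) := fun i => nontrivial_projectivization_pi
  obtain ⟨ρ, hρ⟩ := (hφ.preservesAdjacency hΦ).exists_perm hbij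
  refine ⟨ρ, fun x x' y y' hx hx' hy hy' j hj => ?_⟩
  have := hρ (fun i => mk K (x i) (hx i)) (fun i => mk K (x' i) (hx' i)) j (by simp only [hj])
  rw [hφ x y hx (ne_zero_of_map_prodTensor_eq hx hy) hy,
    hφ x' y' hx' (ne_zero_of_map_prodTensor_eq hx' hy') hy'] at this
  obtain ⟨a, ha⟩ := (mk_eq_mk_iff' K _ _ _ _).1 this
  exact ⟨a, ha.symm⟩

/-- The `j`-th factor of an image under `Φ` is read off along the `j`-th axis through `J`, while the
`ρ j`-th factor of the argument varies and the others are those of `x₀`. -/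
theorem FactorsAlong.exists_factorMap (hΦ : PreservesElementary Φ) {ρ : Equiv.Perm ι}
    (hρ : FactorsAlong Φ ρ) [∀ i, Nonempty (κ i)] (j : ι) :
    ∃ A : (κ (ρ j) → K) →ₗ[K] (κ j → K), ∀ x y : ∀ i, κ i → K, (∀ i, x i ≠ 0) →
      Φ (prodTensor x) = prodTensor y → ∃ a : K, y j = a • A (x (ρ j)) := by
  classical
  have ones_ne_zero : ∀ i, (1 : κ i → K) ≠ 0 := fun i => one_ne_zero
  obtain ⟨y₀, hy₀⟩ := hΦ.exists_map 1
  obtain ⟨J, hJ⟩ := exists_ne_zero_of_prodTensor_ne_zero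
    (prodTensor_ne_zero_iff.2 (ne_zero_of_map_prodTensor_eq ones_ne_zero hy₀))
  refine ⟨LinearMap.funLeft K K (Function.update J j) ∘ₗ Φ.toLinearMap ∘ₗ
    prodTensor.toLinearMap 1 (ρ j), fun x y hx hxy => ?_⟩
  have hv0 : ∀ r, Function.update (1 : ∀ i, κ i → K) (ρ j) (x (ρ j)) r ≠ 0 :=
    forall_update_ne_zero ones_ne_zero (hx (ρ j))
  obtain ⟨z, hz⟩ := hΦ.exists_map (Function.update 1 (ρ j) (x (ρ j)))
  have hP : ∏ r ∈ Finset.univ.erase j, z r (J r) ≠ 0 := Finset.prod_ne_zero_iff.2 fun r hr h => by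
    obtain ⟨a, ha⟩ := hρ 1 _ _ _ ones_ne_zero hv0 hy₀ hz r
      (Function.update_of_ne (ρ.injective.ne (Finset.ne_of_mem_erase hr)) _ _).symm
    exact hJ r (by rw [ha, Pi.smul_apply, h, smul_zero])
  obtain ⟨b, hb⟩ := hρ _ _ _ _ hx hv0 hxy hz j (by rw [Function.update_self])
  refine ⟨b * (∏ r ∈ Finset.univ.erase j, z r (J r))⁻¹, hb.trans ?_⟩
  funext t
  simp only [Pi.smul_apply, smul_eq_mul, LinearMap.comp_apply, LinearMap.funLeft_apply,
    LinearEquiv.coe_coe, MultilinearMap.toLinearMap_apply, hz, prodTensor_apply_update]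
  field_simp

theorem PreservesElementary.exists_map_eq_smul [∀ i, Nontrivial (κ i)]
    (hΦ : PreservesElementary Φ) : ∃ (ρ : Equiv.Perm ι) (A : ∀ j, (κ (ρ j) → K) →ₗ[K] (κ j → K)),
      (∀ j, Function.Injective (A j)) ∧ ∀ x : ∀ i, κ i → K,
        ∃ c : K, c ≠ 0 ∧ Φ (prodTensor x) = c • prodTensor fun j => A j (x (ρ j)) := by
  classical
  obtain ⟨ρ, hρ⟩ := hΦ.exists_factorsAlong
  choose A hA using fun j => hρ.exists_factorMap hΦ j
  have map_ne_zero : ∀ j v, v ≠ 0 → A j v ≠ 0 := fun j v hv h0 => by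
    have hx := forall_update_ne_zero (fun i => one_ne_zero (α := κ i → K)) hv
    obtain ⟨y, hy⟩ := hΦ.exists_map (Function.update 1 (ρ j) v)
    obtain ⟨a, ha⟩ := hA j _ y hx hy
    apply ne_zero_of_map_prodTensor_eq hx hy j
    rw [ha, Function.update_self, h0, smul_zero]
  refine ⟨ρ, A, fun j => (injective_iff_map_eq_zero (A j)).2 fun v =>
    not_imp_not.1 (map_ne_zero j v), fun x => ?_⟩
  by_cases hx : ∀ i, x i ≠ 0
  · obtain ⟨y, hy⟩ := hΦ.exists_map x
    choose a ha using fun j => hA j x y hx hy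
    refine ⟨∏ j, a j, Finset.prod_ne_zero_iff.2 fun j _ h0 => ?_, ?_⟩
    · exact ne_zero_of_map_prodTensor_eq hx hy j (by rw [ha, h0, zero_smul])
    · rw [← MultilinearMap.map_smul_univ, hy]
      exact congrArg prodTensor (funext ha)
  · push Not at hx
    obtain ⟨i, hi⟩ := hx
    obtain ⟨j, rfl⟩ := ρ.surjective i
    refine ⟨1, one_ne_zero, ?_⟩
    rw [prodTensor.map_coord_zero (ρ j) hi, map_zero,
      prodTensor.map_coord_zero j (by rw [hi, map_zero]), smul_zero]

variable [∀ i, Finite (κ i)]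

theorem exists_linearMap_prodTensor_eq {N : Type*} [AddCommGroup N] [Module K N]
    (G : MultilinearMap K (fun i => κ i → K) N) :
    ∃ Ψ : ((∀ i, κ i) → K) →ₗ[K] N, ∀ x, Ψ (prodTensor x) = G x := by
  classical
  have := fun i => Fintype.ofFinite (κ i)
  let Ψ := Fintype.linearCombination K fun J : ∀ i, κ i => G fun i => Pi.single (J i) 1
  refine ⟨Ψ, fun x => ?_⟩
  have eq_on_basis : Ψ.compMultilinearMap prodTensor = G :=
    Module.Basis.ext_multilinear (fun i => Pi.basisFun K (κ i)) fun J => by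
      simp [Ψ, prodTensor_single_one, Fintype.linearCombination_apply_single]
  exact congrArg (· x) eq_on_basis

theorem exists_eq_smul_id_of_prodTensor (Φ : Module.End K ((∀ i, κ i) → K))
    (h : ∀ x : ∀ i, κ i → K, ∃ c : K, Φ (prodTensor x) = c • prodTensor x) :
    ∃ c : K, Φ = c • 1 := by
  classical
  have := fun i => Fintype.ofFinite (κ i)
  have eigenvector : ∀ J, ∃ c : K, Φ (Pi.single J 1) = c • Pi.single J 1 := fun J =>
    prodTensor_single_one (K := K) J ▸ h _
  choose c hc using eigenvector
  obtain ⟨a, ha⟩ := h 1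
  have hone : prodTensor (1 : ∀ i, κ i → K) = ∑ J : ∀ i, κ i, Pi.single J 1 := by
    funext I
    simp [prodTensor_apply, Finset.sum_apply, Pi.single_apply]
  have hca : ∀ J, c J = a := fun J => by
    have := congrFun ha J
    rw [hone, map_sum] at this
    simpa [hc, Finset.sum_apply, Pi.single_apply] using this
  refine ⟨a, LinearMap.pi_ext' fun J => LinearMap.ext_ring ?_⟩
  simp [hc, hca]

theorem PreservesElementary.exists_smul_map_eq [∀ i, Nontrivial (κ i)]
    (hΦ : PreservesElementary Φ) : ∃ (c : K) (ρ : Equiv.Perm ι)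
      (A : ∀ j, (κ (ρ j) → K) →ₗ[K] (κ j → K)), c ≠ 0 ∧ (∀ j, Function.Injective (A j)) ∧
        ∀ x, c • Φ (prodTensor x) = prodTensor fun j => A j (x (ρ j)) := by
  obtain ⟨ρ, A, hA, hΦA⟩ := hΦ.exists_map_eq_smul
  obtain ⟨Ψ, hΨ⟩ := exists_linearMap_prodTensor_eq
    ((MultilinearMap.domDomCongrLinearEquiv' K K (fun i => κ i → K) _ ρ.symm).symm
      (prodTensor.compLinearMap A))
  replace hΨ : ∀ x, Ψ (prodTensor x) = prodTensor fun j => A j (x (ρ j)) := hΨ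
  -- `Φ⁻¹ ∘ Ψ` has every elementary tensor as an eigenvector, so it is a scalar.
  obtain ⟨c, hc⟩ := exists_eq_smul_id_of_prodTensor (Φ.symm.toLinearMap ∘ₗ Ψ) fun x => by
    obtain ⟨a, ha, hx⟩ := hΦA x
    refine ⟨a⁻¹, ?_⟩
    rw [LinearMap.comp_apply, hΨ, LinearEquiv.coe_coe, LinearEquiv.symm_apply_eq, map_smul, hx,
      inv_smul_smul₀ ha]
  have hΨΦ : ∀ T, Ψ T = c • Φ T := fun T => by
    have := LinearMap.congr_fun hc T
    rwa [LinearMap.comp_apply, LinearEquiv.coe_coe, LinearEquiv.symm_apply_eq,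
      LinearMap.smul_apply, map_smul] at this
  refine ⟨c, ρ, A, ?_, hA, fun x => by rw [← hΨΦ, hΨ]⟩
  obtain ⟨a, -, hx⟩ := hΦA 1
  rintro rfl
  rw [← hΨ, hΨΦ, zero_smul, smul_zero, Φ.map_eq_zero_iff] at hx
  exact prodTensor_ne_zero_iff.2 (fun i => one_ne_zero) hx

theorem PreservesElementary.exists_map_eq [Nonempty ι] [∀ i, Nontrivial (κ i)]
    (hΦ : PreservesElementary Φ) : ∃ (ρ : Equiv.Perm ι) (A : ∀ j, (κ (ρ j) → K) →ₗ[K] (κ j → K)),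
      (∀ j, Function.Injective (A j)) ∧
        ∀ x, Φ (prodTensor x) = prodTensor fun j => A j (x (ρ j)) := by
  classical
  obtain ⟨c, ρ, A, hc, hA, hΦA⟩ := hΦ.exists_smul_map_eq
  obtain ⟨j₀⟩ := ‹Nonempty ι›
  let a : ι → K := Function.update 1 j₀ c⁻¹
  have prod_a : ∏ j, a j = c⁻¹ := by simp [a, Finset.prod_update_of_mem]
  have a_ne_zero : ∀ j, a j ≠ 0 :=
    (Function.forall_update_iff (1 : ι → K) fun _ b => b ≠ 0).2
      ⟨inv_ne_zero hc, fun _ _ => one_ne_zero⟩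
  refine ⟨ρ, fun j => a j • A j, fun j => (smul_right_injective _ (a_ne_zero j)).comp (hA j),
    fun x => ?_⟩
  simp only [LinearMap.smul_apply]
  rw [MultilinearMap.map_smul_univ, prod_a, ← hΦA, inv_smul_smul₀ hc]

end ElementaryPreserver

section Rank

open Module

variable {K : Type*} [Field K] {V W : Type*} [AddCommGroup V] [Module K V]
  [AddCommGroup W] [Module K W] [FiniteDimensional K V]

theorem finrank_range_add_le (f g : V →ₗ[K] W) :
    finrank K (f + g).range ≤ finrank K f.range + finrank K g.range := by
  have range_le : (f + g).range ≤ f.range ⊔ g.range := by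
    rintro _ ⟨x, rfl⟩
    exact Submodule.add_mem_sup ⟨x, rfl⟩ ⟨x, rfl⟩
  exact (Submodule.finrank_mono range_le).trans
    (Submodule.finrank_add_le_finrank_add_finrank _ _)

theorem finrank_range_smulRight_le (b : V →ₗ[K] K) (a : W) :
    finrank K (b.smulRight a).range ≤ 1 := by
  have range_eq : b.smulRight a = LinearMap.toSpanSingleton K W a ∘ₗ b := by ext; simp
  rw [range_eq, LinearMap.range_comp]
  exact (Submodule.finrank_map_le _ _).trans
    ((Submodule.finrank_le _).trans (finrank_self K).le)

theorem finrank_range_le_finrank_map_ker_add (g z : V →ₗ[K] W) :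
    finrank K g.range ≤ finrank K (z.ker.map g) + finrank K z.range := by
  obtain ⟨C, hC⟩ := Submodule.exists_isCompl z.ker
  have range_eq : g.range = z.ker.map g ⊔ C.map g := by
    rw [← Submodule.map_sup, hC.sup_eq_top, LinearMap.range_eq_map]
  have finrank_C : finrank K C = finrank K z.range := by
    have := Submodule.finrank_add_eq_of_isCompl hC
    have := z.finrank_range_add_finrank_ker
    omega
  rw [range_eq, ← finrank_C]
  exact (Submodule.finrank_add_le_finrank_add_finrank _ _).trans
    (Nat.add_le_add_left (Submodule.finrank_map_le _ _) _)

/- Both ranges contain `f (ker z)`. If it has dimension `k` they are equal to it, and then it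
contains the range of `z` too; otherwise there is room for one more dimension. -/
theorem finrank_range_add_smul_le {k : ℕ} {f z : V →ₗ[K] W} (hz : finrank K z.range ≤ 1)
    (hf : finrank K f.range ≤ k) (hfz : finrank K (f + z).range ≤ k) (c : K) :
    finrank K (f + c • z).range ≤ k := by
  have map_ker (c : K) : z.ker.map (f + c • z) = z.ker.map f :=
    SetLike.coe_injective (Set.image_congr fun x hx => by simp [LinearMap.mem_ker.1 hx])
  have map_ker_le (c : K) : z.ker.map f ≤ (f + c • z).range := map_ker c ▸ LinearMap.map_le_range
  rcases lt_or_ge (finrank K (z.ker.map f)) k with hlt | hge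
  · have := finrank_range_le_finrank_map_ker_add (f + c • z) z
    rw [map_ker] at this
    omega
  · have range_f : z.ker.map f = f.range :=
      Submodule.eq_of_le_of_finrank_le (by simpa using map_ker_le 0) (hf.trans hge)
    have range_fz : z.ker.map f = (f + z).range :=
      Submodule.eq_of_le_of_finrank_le (by simpa using map_ker_le 1) (hfz.trans hge)
    have range_le : (f + c • z).range ≤ f.range := by
      rintro _ ⟨x, rfl⟩
      have hz : z x ∈ f.range := by
        have : (f + z) x ∈ f.range := range_f ▸ range_fz ▸ LinearMap.mem_range_self _ x
        simpa using sub_mem this (LinearMap.mem_range_self f x)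
      exact add_mem (LinearMap.mem_range_self f x) (Submodule.smul_mem _ c hz)
    exact (Submodule.finrank_mono range_le).trans hf

theorem exists_linearMap_finrank_range_eq [FiniteDimensional K W] {s : ℕ} {A : Submodule K V}
    {B : Submodule K W} (hA : s ≤ finrank K A) (hB : s ≤ finrank K B) :
    ∃ N : V →ₗ[K] W, finrank K N.range = s ∧ N.range ≤ B ∧ N.range ≤ A.map N := by
  rw [← finrank_fin_fun K (n := s)] at hA hB
  obtain ⟨i, hi⟩ := finrank_le_iff_exists_linearMap.1 hA
  obtain ⟨j, hj⟩ := finrank_le_iff_exists_linearMap.1 hB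
  obtain ⟨p, hp⟩ := LinearMap.exists_leftInverse_of_injective (A.subtype ∘ₗ i)
    (LinearMap.ker_eq_bot.2 (A.injective_subtype.comp hi))
  have hpi (x : Fin s → K) : p (i x) = x := LinearMap.congr_fun hp x
  refine ⟨(B.subtype ∘ₗ j) ∘ₗ p, ?_, ?_, ?_⟩
  · rw [LinearMap.range_comp_of_range_eq_top _ (LinearMap.range_eq_top.2 fun x => ⟨_, hpi x⟩),
      LinearMap.finrank_range_of_inj (f := B.subtype ∘ₗ j) (B.injective_subtype.comp hj),
      finrank_fin_fun]
  · rintro _ ⟨x, rfl⟩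
    exact (j (p x)).2
  · rintro _ ⟨x, rfl⟩
    exact ⟨i (p x), (i (p x)).2, by simp [hpi]⟩

theorem exists_finrank_range_add_lt {z : V →ₗ[K] W} (hz : z ≠ 0) {c : K} (hc : c ≠ 0)
    (hc1 : c ≠ 1) :
    ∃ r : V →ₗ[K] W, finrank K r.range ≤ 1 ∧ z.ker ≤ r.ker ∧
      finrank K (r + z).range < finrank K z.range ∧ z.range ≤ (r + c • z).range := by
  obtain ⟨x₀, hx₀⟩ : ∃ x, z x ≠ 0 := by
    by_contra! h
    exact hz (LinearMap.ext h)
  obtain ⟨l, hl⟩ := Projective.exists_dual_eq_one K hx₀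
  refine ⟨(l ∘ₗ z).smulRight (-z x₀), finrank_range_smulRight_le _ _, ?_, ?_, ?_⟩
  · intro x hx
    simp [LinearMap.mem_ker.1 hx]
  · refine Submodule.finrank_lt_finrank_of_lt (lt_of_le_of_ne ?_ fun h => ?_)
    · rintro _ ⟨x, rfl⟩
      exact ⟨x - l (z x) • x₀, by simp [sub_eq_neg_add]⟩
    · obtain ⟨x, hx⟩ : z x₀ ∈ ((l ∘ₗ z).smulRight (-z x₀) + z).range :=
        h ▸ LinearMap.mem_range_self z x₀
      simpa [hl] using congrArg l hx
  · rintro _ ⟨x, rfl⟩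
    have hc1' : c - 1 ≠ 0 := sub_ne_zero.2 hc1
    refine ⟨c⁻¹ • (x + (l (z x) / (c - 1)) • x₀), ?_⟩
    simp only [LinearMap.add_apply, LinearMap.smulRight_apply, LinearMap.comp_apply, map_smul,
      map_add, hl, LinearMap.smul_apply, smul_neg]
    match_scalars <;> field_simp
    ring

theorem finrank_range_add_finrank_range_le [FiniteDimensional K W] {z g N : V →ₗ[K] W}
    (hdisj : Disjoint z.range N.range) (hz : z.range ≤ g.range) (hker : z.ker ≤ g.ker)
    (hN : N.range ≤ z.ker.map N) :
    finrank K z.range + finrank K N.range ≤ finrank K (g + N).range := by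
  have N_le_range : N.range ≤ (g + N).range := by
    refine hN.trans ?_
    rintro _ ⟨x, hx, rfl⟩
    exact ⟨x, by simp [LinearMap.mem_ker.1 (hker hx)]⟩
  have z_le_range : z.range ≤ (g + N).range := by
    refine hz.trans ?_
    rintro _ ⟨x, rfl⟩
    rw [← add_sub_cancel_right (g x) (N x), ← LinearMap.add_apply]
    exact sub_mem (LinearMap.mem_range_self _ x) (N_le_range ⟨x, rfl⟩)
  rw [← Submodule.finrank_sup_add_finrank_inf_eq, hdisj.eq_bot, finrank_bot, add_zero]
  exact Submodule.finrank_mono (sup_le z_le_range N_le_range)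

theorem exists_lt_finrank_range_add_smul [FiniteDimensional K W] {k : ℕ} {z : V →ₗ[K] W}
    (hz : 2 ≤ finrank K z.range) (hk : finrank K z.range ≤ k) (hV : k < finrank K V)
    (hW : k < finrank K W) {c : K} (hc : c ≠ 0) (hc1 : c ≠ 1) :
    ∃ v : V →ₗ[K] W, finrank K v.range ≤ k ∧ finrank K (v + z).range ≤ k ∧
      k < finrank K (v + c • z).range := by
  have z_ne_zero : z ≠ 0 := by
    rintro rfl
    rw [LinearMap.range_zero, finrank_bot] at hz
    omega
  obtain ⟨r, r_rank, r_ker, rz_rank, z_le⟩ := exists_finrank_range_add_lt z_ne_zero hc hc1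
  obtain ⟨R, hR⟩ := Submodule.exists_isCompl z.range
  obtain ⟨N, N_rank, N_le, N_ker⟩ : ∃ N : V →ₗ[K] W, finrank K N.range =
      k + 1 - finrank K z.range ∧ N.range ≤ R ∧ N.range ≤ z.ker.map N := by
    refine exists_linearMap_finrank_range_eq ?_ ?_
    · have := z.finrank_range_add_finrank_ker
      omega
    · have := Submodule.finrank_add_eq_of_isCompl hR
      omega
  refine ⟨r + N, ?_, ?_, ?_⟩
  · have := finrank_range_add_le r N
    omega
  · have := finrank_range_add_le (r + z) N
    rw [add_right_comm]
    omega
  · have ker_le : z.ker ≤ (r + c • z).ker := fun x hx => by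
      simp [LinearMap.mem_ker.1 hx, LinearMap.mem_ker.1 (r_ker hx)]
    have := finrank_range_add_finrank_range_le (hR.disjoint.mono_right N_le) z_le ker_le N_ker
    rw [add_right_comm]
    omega

end Rank

section LowRank

open Module

theorem single_prod_eq_mul {K α β : Type*} [MulZeroOneClass K] [DecidableEq α] [DecidableEq β]
    (i : α) (j : β) :
    (Pi.single (i, j) 1 : α × β → K) =
      fun p => (Pi.single i 1 : α → K) p.1 * (Pi.single j 1 : β → K) p.2 := by
  ext p
  simp [Pi.single_apply, Prod.ext_iff, ← ite_and, and_comm]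

variable {K : Type*} [Field K] {α β : Type*} [Fintype β] [DecidableEq β] {k : ℕ}

/-- A vector of `K^α ⊗ K^β` as the linear map `K^β → K^α` with the same coefficients; its rank is
the tensor rank of the vector. -/
def coeffMap : (α × β → K) ≃ₗ[K] (β → K) →ₗ[K] α → K :=
  LinearEquiv.curry K K α β ≪≫ₗ Matrix.ofLinearEquiv K ≪≫ₗ Matrix.toLin'

theorem coeffMap_single (v : α × β → K) (i : α) (j : β) :
    coeffMap v (Pi.single j 1) i = v (i, j) := by
  simp [coeffMap]

/-- The vectors of tensor rank at most `k`. -/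
def LowRank (k : ℕ) (v : α × β → K) : Prop := finrank K (coeffMap v).range ≤ k

theorem LowRank.mono {l : ℕ} {v : α × β → K} (h : LowRank k v) (hkl : k ≤ l) : LowRank l v :=
  h.trans hkl

theorem lowRank_iff_exists_sum [Finite α] {v : α × β → K} :
    LowRank k v ↔ ∃ (a : Fin k → α → K) (b : Fin k → β → K),
      v = fun p => ∑ l, a l p.1 * b l p.2 := by
  constructor
  · intro h
    rw [LowRank, ← finrank_fin_fun K (n := k)] at h
    obtain ⟨b, hb⟩ := finrank_le_iff_exists_linearMap.1 h
    obtain ⟨a, hab⟩ := LinearMap.exists_leftInverse_of_injective b (LinearMap.ker_eq_bot.2 hb)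
    let w (j : β) : (coeffMap v).range := ⟨coeffMap v (Pi.single j 1), LinearMap.mem_range_self _ _⟩
    refine ⟨fun l => a (Pi.single l 1), fun l j => b (w j) l, funext fun ⟨i, j⟩ => ?_⟩
    have h : a (∑ l, b (w j) l • Pi.single l 1) = w j := by
      rw [← pi_eq_sum_univ' (b (w j))]
      exact LinearMap.congr_fun hab (w j)
    rw [← coeffMap_single v i j, show coeffMap v (Pi.single j 1) = w j from rfl, ← h]
    simp [mul_comm]
  · rintro ⟨a, b, rfl⟩
    have eq_mul : coeffMap (fun p : α × β => ∑ l, a l p.1 * b l p.2) =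
        (Matrix.of fun i l => a l i).mulVecLin ∘ₗ (Matrix.of b).mulVecLin := by
      rw [← Matrix.mulVecLin_mul]
      rfl
    rw [LowRank, eq_mul]
    exact (Submodule.finrank_mono (LinearMap.range_comp_le_range _ _)).trans
      ((LinearMap.finrank_range_le _).trans (finrank_fin_fun K).le)

theorem lowRank_one_iff [Finite α] {v : α × β → K} :
    LowRank 1 v ↔ ∃ (a : α → K) (b : β → K), v = fun p => a p.1 * b p.2 := by
  simp only [lowRank_iff_exists_sum, Fin.sum_univ_one]
  exact ⟨fun ⟨a, b, h⟩ => ⟨a 0, b 0, h⟩, fun ⟨a, b, h⟩ => ⟨fun _ => a, fun _ => b, h⟩⟩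

theorem lowRank_one_single [Finite α] [DecidableEq α] (p : α × β) :
    LowRank 1 (Pi.single p 1 : α × β → K) :=
  lowRank_one_iff.2 ⟨_, _, single_prod_eq_mul p.1 p.2⟩

theorem lowRank_zero : LowRank k (0 : α × β → K) := by
  rw [LowRank, map_zero, LinearMap.range_zero, finrank_bot]
  exact Nat.zero_le k

theorem LowRank.smul {v : α × β → K} (h : LowRank k v) (c : K) : LowRank k (c • v) := by
  have range_le : (coeffMap (c • v)).range ≤ (coeffMap v).range := by
    rintro _ ⟨x, rfl⟩
    exact ⟨c • x, by simp⟩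
  exact (Submodule.finrank_mono range_le).trans h

theorem LowRank.add_smul {v z : α × β → K} (hv : LowRank k v) (hz : LowRank 1 z)
    (hvz : LowRank k (v + z)) (c : K) : LowRank k (v + c • z) := by
  rw [LowRank, map_add] at *
  rw [map_smul]
  exact finrank_range_add_smul_le hz hv hvz c

theorem exists_not_lowRank [Fintype α] {z : α × β → K} (hz : LowRank k z) (hz1 : ¬ LowRank 1 z)
    (hα : k < Fintype.card α) (hβ : k < Fintype.card β) {c : K} (hc : c ≠ 0) (hc1 : c ≠ 1) :
    ∃ v : α × β → K, LowRank k v ∧ LowRank k (v + z) ∧ ¬ LowRank k (v + c • z) := by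
  obtain ⟨f, hf, hfz, hfcz⟩ := exists_lt_finrank_range_add_smul (not_le.1 hz1) hz
    (by simpa using hβ) (by simpa using hα) hc hc1
  obtain ⟨v, rfl⟩ := coeffMap.surjective f
  rw [← map_add] at hfz
  rw [← map_smul, ← map_add] at hfcz
  exact ⟨v, hf, hfz, not_le.2 hfcz⟩

theorem isClosed_setOf_lowRank [Finite α] : IsClosed {v : α × β → ℂ | LowRank k v} := by
  have := Fintype.ofFinite α
  let T (v : α × β → ℂ) : (β → ℂ) →L[ℂ] α → ℂ := LinearMap.toContinuousLinearMap (coeffMap v)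
  have hT : Continuous T := LinearMap.continuous_of_finiteDimensional
    (LinearMap.toContinuousLinearMap.toLinearMap ∘ₗ (coeffMap (K := ℂ) (α := α)).toLinearMap)
  convert! ((isOpen_setOfPred_nat_le_rank (k + 1)).preimage hT).isClosed_compl using 1
  ext v
  change LowRank k v ↔ ¬((k + 1 : ℕ) : Cardinal) ≤ (coeffMap v).rank
  rw [LinearMap.rank, ← finrank_eq_rank, Nat.cast_le, not_le, Nat.lt_succ_iff, LowRank]

end LowRank

section LowRankOp

open Matrix

variable {K : Type*} [Field K]

theorem exists_eq_smul_of_vecMulVec_add_eq {σ τ : Type*} {v z p : σ → K} {u w q : τ → K}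
    (hz : z ≠ 0) (hw : w ≠ 0) (h : vecMulVec v u + vecMulVec z w = vecMulVec p q) :
    (∃ c : K, v = c • z) ∨ ∃ c : K, u = c • w := by
  have h (s : σ) (j : τ) : v s * u j + z s * w j = p s * q j := congrFun (congrFun h s) j
  by_cases hvz : ∀ s t, z s * v t = z t * v s
  · exact .inl (exists_eq_smul_of_minors hz hvz)
  push Not at hvz
  obtain ⟨s, t, hst⟩ := hvz
  refine .inr (exists_eq_smul_of_minors hw fun i j => ?_)
  have det_ne_zero : v s * z t - v t * z s ≠ 0 := fun h => hst (by linear_combination -h)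
  have hu (j : τ) : (v s * z t - v t * z s) * u j = (z t * p s - z s * p t) * q j := by
    linear_combination z t * h s j - z s * h t j
  have hw (j : τ) : (v s * z t - v t * z s) * w j = (v s * p t - v t * p s) * q j := by
    linear_combination v s * h t j - v t * h s j
  refine mul_left_cancel₀ (mul_ne_zero det_ne_zero det_ne_zero) ?_
  linear_combination (v s * z t - v t * z s) * u j * hw i + (v s * p t - v t * p s) * q i * hu j -
    (v s * z t - v t * z s) * u i * hw j - (v s * p t - v t * p s) * q j * hu i

variable {α β : Type*} [Fintype β] [DecidableEq β] {k : ℕ}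

/-- The operators `v wᵀ` on `K^α ⊗ K^β` with `v` and `w` of tensor rank at most `k`. -/
def LowRankOp (k : ℕ) (X : Matrix (α × β) (α × β) K) : Prop :=
  ∃ v w, LowRank k v ∧ LowRank k w ∧ X = vecMulVec v w

variable {X Y Z : Matrix (α × β) (α × β) K}

theorem LowRankOp.mono {l : ℕ} (h : LowRankOp k X) (hkl : k ≤ l) : LowRankOp l X := by
  obtain ⟨v, w, hv, hw, rfl⟩ := h
  exact ⟨v, w, hv.mono hkl, hw.mono hkl, rfl⟩

theorem LowRankOp.smul (h : LowRankOp k X) (c : K) : LowRankOp k (c • X) := by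
  obtain ⟨v, w, hv, hw, rfl⟩ := h
  exact ⟨c • v, w, hv.smul c, hw, (smul_vecMulVec c v w).symm⟩

theorem LowRankOp.transpose (h : LowRankOp k X) : LowRankOp k Xᵀ := by
  obtain ⟨v, w, hv, hw, rfl⟩ := h
  exact ⟨w, v, hw, hv, transpose_vecMulVec v w⟩

theorem LowRankOp.left {v w : α × β → K} (h : LowRankOp k (vecMulVec v w)) (hw : w ≠ 0) :
    LowRank k v := by
  obtain ⟨p, q, hp, -, e⟩ := h
  obtain ⟨s, hs⟩ := Function.ne_iff.1 hw
  rw [Pi.zero_apply] at hs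
  have v_eq : v = (q s / w s) • p := by
    funext r
    have h : v r * w s = p r * q s := congrFun (congrFun e r) s
    rw [Pi.smul_apply, smul_eq_mul]
    field_simp
    linear_combination h
  exact v_eq ▸ hp.smul _

theorem LowRankOp.add_smul_of_right {v z w : α × β → K} (hv : LowRank k v) (hz : LowRank 1 z)
    (hw : LowRank k w) (h : LowRankOp k (vecMulVec v w + vecMulVec z w)) (c : K) :
    LowRankOp k (vecMulVec v w + c • vecMulVec z w) := by
  by_cases hw0 : w = 0
  · subst hw0
    exact ⟨v, 0, hv, hw, by simp⟩
  rw [← add_vecMulVec] at h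
  rw [← smul_vecMulVec, ← add_vecMulVec]
  exact ⟨_, w, hv.add_smul hz (h.left hw0) c, hw, rfl⟩

theorem LowRankOp.add_smul_of_left {u w z : α × β → K} (hu : LowRank k u) (hw : LowRank 1 w)
    (hz : LowRank k z) (h : LowRankOp k (vecMulVec z u + vecMulVec z w)) (c : K) :
    LowRankOp k (vecMulVec z u + c • vecMulVec z w) := by
  have h : LowRankOp k (vecMulVec u z + vecMulVec w z) := by
    simpa [transpose_vecMulVec] using h.transpose
  simpa [transpose_vecMulVec] using (add_smul_of_right hu hw hz h c).transpose

theorem LowRankOp.add_smul (hk : 1 ≤ k) (hY : LowRankOp k Y) (hZ : LowRankOp 1 Z)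
    (hYZ : LowRankOp k (Y + Z)) (c : K) : LowRankOp k (Y + c • Z) := by
  obtain ⟨v, u, hv, hu, rfl⟩ := hY
  obtain ⟨z, w, hz, hw, rfl⟩ := hZ
  by_cases hz0 : z = 0
  · exact ⟨v, u, hv, hu, by simp [hz0]⟩
  by_cases hw0 : w = 0
  · exact ⟨v, u, hv, hu, by simp [hw0]⟩
  have ⟨p, q, _, _, e⟩ := hYZ
  obtain ⟨a, rfl⟩ | ⟨a, rfl⟩ := exists_eq_smul_of_vecMulVec_add_eq hz0 hw0 e
  · rw [smul_vecMulVec, ← vecMulVec_smul] at hYZ ⊢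
    exact add_smul_of_left (hu.smul a) hw (hz.mono hk) hYZ c
  · rw [vecMulVec_smul, ← smul_vecMulVec] at hYZ ⊢
    exact add_smul_of_right (hv.smul a) hz (hw.mono hk) hYZ c

variable [Fintype α]

theorem lowRank_one_of_forall_add_smul {z w : α × β → K} (hα : k < Fintype.card α)
    (hβ : k < Fintype.card β) (hz : LowRank k z) (hw : LowRank k w) (hw0 : w ≠ 0) {c : K}
    (hc : c ≠ 0) (hc1 : c ≠ 1)
    (h : ∀ Y, LowRankOp k Y → LowRankOp k (Y + vecMulVec z w) →
      LowRankOp k (Y + c • vecMulVec z w)) : LowRank 1 z := by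
  by_contra hz1
  obtain ⟨v, hv, hvz, hvcz⟩ := exists_not_lowRank hz hz1 hα hβ hc hc1
  refine hvcz (LowRankOp.left (w := w) ?_ hw0)
  rw [add_vecMulVec, smul_vecMulVec]
  exact h _ ⟨v, w, hv, hw, rfl⟩ ⟨v + z, w, hvz, hw, (add_vecMulVec v z w).symm⟩

theorem LowRankOp.one_of_forall_add_smul (hα : k < Fintype.card α) (hβ : k < Fintype.card β)
    (hZ : LowRankOp k Z) {c : K} (hc : c ≠ 0) (hc1 : c ≠ 1)
    (h : ∀ Y, LowRankOp k Y → LowRankOp k (Y + Z) → LowRankOp k (Y + c • Z)) :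
    LowRankOp 1 Z := by
  obtain ⟨z, w, hz, hw, rfl⟩ := hZ
  by_cases hz0 : z = 0
  · exact ⟨0, 0, lowRank_zero, lowRank_zero, by simp [hz0]⟩
  by_cases hw0 : w = 0
  · exact ⟨0, 0, lowRank_zero, lowRank_zero, by simp [hw0]⟩
  refine ⟨z, w, lowRank_one_of_forall_add_smul hα hβ hz hw hw0 hc hc1 h,
    lowRank_one_of_forall_add_smul hα hβ hw hz hz0 hc hc1 fun Y hY hYZ => ?_, rfl⟩
  have hYZ : LowRankOp k (Yᵀ + vecMulVec z w) := by
    simpa [transpose_vecMulVec] using hYZ.transpose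
  simpa [transpose_vecMulVec] using (h Yᵀ hY.transpose hYZ).transpose

theorem LowRankOp.map_one (hk : 1 ≤ k) (hα : k < Fintype.card α) (hβ : k < Fintype.card β)
    (hK : ∃ c : K, c ≠ 0 ∧ c ≠ 1) {Φ : Matrix (α × β) (α × β) K ≃ₗ[K] Matrix (α × β) (α × β) K}
    (h : ∀ X, LowRankOp k (Φ X) ↔ LowRankOp k X) (hX : LowRankOp 1 X) : LowRankOp 1 (Φ X) := by
  obtain ⟨c, hc, hc1⟩ := hK
  refine ((h X).2 (hX.mono hk)).one_of_forall_add_smul hα hβ hc hc1 fun Y hY hYX => ?_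
  obtain ⟨Y, rfl⟩ := Φ.surjective Y
  rw [← map_add, h] at hYX
  rw [← map_smul, ← map_add, h]
  exact ((h Y).1 hY).add_smul hk hX hYX c

theorem lowRankOp_one_map_iff (hk : 1 ≤ k) (hα : k < Fintype.card α) (hβ : k < Fintype.card β)
    (hK : ∃ c : K, c ≠ 0 ∧ c ≠ 1) {Φ : Matrix (α × β) (α × β) K ≃ₗ[K] Matrix (α × β) (α × β) K}
    (h : ∀ X, LowRankOp k (Φ X) ↔ LowRankOp k X) : LowRankOp 1 (Φ Z) ↔ LowRankOp 1 Z := by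
  refine ⟨fun hZ => ?_, LowRankOp.map_one hk hα hβ hK h⟩
  simpa using LowRankOp.map_one hk hα hβ hK (Φ := Φ.symm)
    (fun X => by rw [← h, Φ.apply_symm_apply]) hZ

end LowRankOp

section AtomicNorm

variable {𝕜 E : Type*} [RCLike 𝕜] [NormedAddCommGroup E] [InnerProductSpace 𝕜 E] {S : Set E}
  {Φ : E →ₗ[𝕜] E} {x y s : E}

/-- A compact set of unit vectors that spans the space and is stable under phases. It serves as the
set of atoms of a norm, which is then given by `atomicNorm`, and of its dual, `supportNorm`. -/
structure IsAtomSet (𝕜 : Type*) {E : Type*} [RCLike 𝕜] [NormedAddCommGroup E]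
    [InnerProductSpace 𝕜 E] (S : Set E) : Prop where
  isCompact : IsCompact S
  span_eq_top : Submodule.span 𝕜 S = ⊤
  norm_eq_one {s : E} : s ∈ S → ‖s‖ = 1
  smul_mem {c : 𝕜} {s : E} : ‖c‖ = 1 → s ∈ S → c • s ∈ S

/-- The dual of the norm with atoms `S`: the largest overlap of a vector with an atom. -/
def supportNorm (𝕜 : Type*) {E : Type*} [RCLike 𝕜] [NormedAddCommGroup E] [InnerProductSpace 𝕜 E]
    (S : Set E) (x : E) : ℝ :=
  sSup ((fun s => ‖inner 𝕜 s x‖) '' S)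

/-- The norm with atoms `S`: the least total weight of a decomposition of a vector into atoms. -/
def atomicNorm (𝕜 : Type*) {E : Type*} [RCLike 𝕜] [NormedAddCommGroup E] [InnerProductSpace 𝕜 E]
    (S : Set E) (x : E) : ℝ :=
  sInf {r | ∃ (N : ℕ) (c : Fin N → 𝕜) (s : Fin N → E),
    (∀ i, s i ∈ S) ∧ x = ∑ i, c i • s i ∧ r = ∑ i, ‖c i‖}

theorem supportNorm_nonneg : 0 ≤ supportNorm 𝕜 S x :=
  Real.sSup_nonneg <| Set.forall_mem_image.2 fun _ _ => norm_nonneg _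

theorem supportNorm_le {r : ℝ} (hr : 0 ≤ r) (h : ∀ s ∈ S, ‖inner 𝕜 s x‖ ≤ r) :
    supportNorm 𝕜 S x ≤ r :=
  Real.sSup_le (Set.forall_mem_image.2 h) hr

theorem supportNorm_zero : supportNorm 𝕜 S 0 = 0 :=
  (supportNorm_le le_rfl (by simp)).antisymm supportNorm_nonneg

theorem atomicNorm_nonneg : 0 ≤ atomicNorm 𝕜 S x :=
  Real.sInf_nonneg <| by rintro _ ⟨N, c, s, -, -, rfl⟩; positivity

theorem atomicNorm_sum_le {N : ℕ} {a : Fin N → E} (ha : ∀ i, a i ∈ S) (c : Fin N → 𝕜) :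
    atomicNorm 𝕜 S (∑ i, c i • a i) ≤ ∑ i, ‖c i‖ :=
  csInf_le ⟨0, by rintro _ ⟨N, c, s, -, -, rfl⟩; positivity⟩ ⟨N, c, a, ha, rfl, rfl⟩

theorem atomicNorm_le_one (hs : s ∈ S) : atomicNorm 𝕜 S s ≤ 1 := by
  simpa using atomicNorm_sum_le (fun _ : Fin 1 => hs) fun _ => (1 : 𝕜)

namespace IsAtomSet

variable (hS : IsAtomSet 𝕜 S)
include hS

theorem norm_inner_le_norm (hs : s ∈ S) : ‖inner 𝕜 s x‖ ≤ ‖x‖ := by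
  simpa [hS.norm_eq_one hs] using _root_.norm_inner_le_norm s x

theorem norm_inner_le_supportNorm (hs : s ∈ S) : ‖inner 𝕜 s x‖ ≤ supportNorm 𝕜 S x :=
  le_csSup ⟨‖x‖, Set.forall_mem_image.2 fun _ => hS.norm_inner_le_norm⟩ ⟨s, hs, rfl⟩

theorem supportNorm_le_norm : supportNorm 𝕜 S x ≤ ‖x‖ :=
  supportNorm_le (norm_nonneg x) fun _ => hS.norm_inner_le_norm

theorem supportNorm_eq_one (hs : s ∈ S) : supportNorm 𝕜 S s = 1 := by
  refine le_antisymm (hS.norm_eq_one hs ▸ hS.supportNorm_le_norm) ?_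
  simpa [inner_self_eq_norm_sq_to_K, hS.norm_eq_one hs] using
    hS.norm_inner_le_supportNorm (x := s) hs

theorem eq_zero_of_supportNorm_eq_zero (hx : supportNorm 𝕜 S x = 0) : x = 0 := by
  have inner_eq_zero (s : E) (hs : s ∈ S) : inner 𝕜 s x = 0 :=
    norm_le_zero_iff.1 (hx ▸ hS.norm_inner_le_supportNorm hs)
  have mem_orthogonal : x ∈ (Submodule.span 𝕜 S)ᗮ := by
    rw [Submodule.mem_orthogonal]
    exact fun s hs => Submodule.span_induction inner_eq_zero (by simp)
      (fun y z _ _ hy hz => by simp [inner_add_left, hy, hz])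
      (fun c y _ hy => by simp [inner_smul_left, hy]) hs
  simpa [hS.span_eq_top] using mem_orthogonal

theorem le_atomicNorm {r : ℝ} (h : ∀ (N : ℕ) (c : Fin N → 𝕜) (a : Fin N → E),
    (∀ i, a i ∈ S) → x = ∑ i, c i • a i → r ≤ ∑ i, ‖c i‖) : r ≤ atomicNorm 𝕜 S x := by
  refine le_csInf ?_ ?_
  · have hx : x ∈ Submodule.span 𝕜 S := hS.span_eq_top ▸ Submodule.mem_top
    obtain ⟨N, c, a, hx⟩ := Submodule.mem_span_set'.1 hx
    exact ⟨_, N, c, fun i => a i, fun i => (a i).2, hx.symm, rfl⟩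
  · rintro _ ⟨N, c, a, ha, hx, rfl⟩
    exact h N c a ha hx

theorem norm_le_atomicNorm : ‖x‖ ≤ atomicNorm 𝕜 S x :=
  hS.le_atomicNorm fun N c a ha hx => by
    refine hx ▸ norm_sum_le_of_le _ fun i _ => ?_
    rw [norm_smul, hS.norm_eq_one (ha i), mul_one]

theorem norm_inner_le_atomicNorm_mul_supportNorm :
    ‖inner 𝕜 x y‖ ≤ atomicNorm 𝕜 S x * supportNorm 𝕜 S y := by
  rcases supportNorm_nonneg.eq_or_lt (a := 0) (b := supportNorm 𝕜 S y) with hy | hy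
  · simp [hS.eq_zero_of_supportNorm_eq_zero hy.symm, atomicNorm_nonneg, supportNorm_nonneg,
      mul_nonneg]
  rw [← div_le_iff₀ hy]
  refine hS.le_atomicNorm fun N c a ha hx => ?_
  rw [div_le_iff₀ hy, hx, sum_inner, Finset.sum_mul]
  refine norm_sum_le_of_le _ fun i _ => ?_
  rw [inner_smul_left, norm_mul, RCLike.norm_conj]
  exact mul_le_mul_of_nonneg_left (hS.norm_inner_le_supportNorm (ha i)) (norm_nonneg _)

theorem atomicNorm_map_le (h : Set.MapsTo Φ S S) : atomicNorm 𝕜 S (Φ x) ≤ atomicNorm 𝕜 S x :=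
  hS.le_atomicNorm fun N c a ha hx => by
    simpa [hx] using atomicNorm_sum_le (fun i => h (ha i)) c

variable [FiniteDimensional 𝕜 E]

theorem subset_image_adjoint (h : ∀ x, supportNorm 𝕜 S (Φ x) = supportNorm 𝕜 S x) :
    S ⊆ Φ.adjoint '' S := by
  intro s hs
  obtain ⟨t, ht, sup_eq⟩ := hS.isCompact.exists_sSup_image_eq ⟨s, hs⟩
    (f := fun t => ‖inner 𝕜 t (Φ s)‖) (by fun_prop)
  have overlap : ‖inner 𝕜 s (Φ.adjoint t)‖ = 1 := by
    rw [norm_inner_symm, LinearMap.adjoint_inner_left, ← hS.supportNorm_eq_one hs, ← h s]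
    exact sup_eq.symm
  have norm_le : ‖Φ.adjoint t‖ ≤ 1 := by
    have : ‖Φ.adjoint t‖ * ‖Φ.adjoint t‖ ≤ ‖Φ.adjoint t‖ :=
      calc ‖Φ.adjoint t‖ * ‖Φ.adjoint t‖ = ‖inner 𝕜 t (Φ (Φ.adjoint t))‖ := by
            rw [← LinearMap.adjoint_inner_left, inner_self_eq_norm_sq_to_K]; simp [sq]
        _ ≤ supportNorm 𝕜 S (Φ (Φ.adjoint t)) := hS.norm_inner_le_supportNorm ht
        _ = supportNorm 𝕜 S (Φ.adjoint t) := h _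
        _ ≤ ‖Φ.adjoint t‖ := hS.supportNorm_le_norm
    nlinarith
  have norm_eq : ‖Φ.adjoint t‖ = 1 :=
    norm_le.antisymm (overlap ▸ hS.norm_inner_le_norm hs)
  have attained : ‖inner 𝕜 s (Φ.adjoint t)‖ = ‖s‖ * ‖Φ.adjoint t‖ := by
    rw [overlap, hS.norm_eq_one hs, norm_eq, one_mul]
  obtain ⟨c, hc, adjoint_eq⟩ := (norm_inner_eq_norm_iff
    (norm_ne_zero_iff.1 <| (hS.norm_eq_one hs).trans_ne one_ne_zero)
    (norm_ne_zero_iff.1 <| norm_eq.trans_ne one_ne_zero)).1 attained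
  have norm_c : ‖c‖ = 1 := by
    simpa [norm_smul, hS.norm_eq_one hs, norm_eq] using (congrArg norm adjoint_eq).symm
  refine ⟨c⁻¹ • t, hS.smul_mem (by simp [norm_c]) ht, ?_⟩
  rw [map_smul, adjoint_eq, inv_smul_smul₀ hc]

theorem supportNorm_preserving_iff :
    (∀ x, supportNorm 𝕜 S (Φ x) = supportNorm 𝕜 S x) ↔ Φ.adjoint '' S = S := by
  constructor
  · intro h
    have injective : Function.Injective Φ := (injective_iff_map_eq_zero Φ).2 fun x hx =>
      hS.eq_zero_of_supportNorm_eq_zero (by rw [← h, hx, supportNorm_zero])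
    obtain ⟨Φ, rfl⟩ : ∃ Φ' : E ≃ₗ[𝕜] E, Φ'.toLinearMap = Φ :=
      ⟨.ofInjectiveEndo Φ injective, by ext; simp⟩
    have hsymm : S ⊆ Φ.symm.toLinearMap.adjoint '' S :=
      hS.subset_image_adjoint fun x => by simpa using (h (Φ.symm x)).symm
    refine (hS.subset_image_adjoint h).antisymm' ?_
    calc Φ.toLinearMap.adjoint '' S
        ⊆ Φ.toLinearMap.adjoint '' (Φ.symm.toLinearMap.adjoint '' S) := Set.image_mono hsymm
      _ = S := by
        rw [← Set.image_comp, ← LinearMap.coe_comp, ← LinearMap.adjoint_comp]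
        simp
  · intro h x
    have : (fun s => ‖inner 𝕜 s x‖) '' S = (fun s => ‖inner 𝕜 s (Φ x)‖) '' S := by
      conv_lhs => rw [← h, Set.image_image]
      simp only [LinearMap.adjoint_inner_left]
    rw [supportNorm, supportNorm, this]

theorem supportNorm_adjoint_le (h : ∀ x, atomicNorm 𝕜 S (Φ x) = atomicNorm 𝕜 S x) :
    supportNorm 𝕜 S (Φ.adjoint x) ≤ supportNorm 𝕜 S x :=
  supportNorm_le supportNorm_nonneg fun s hs =>
    calc ‖inner 𝕜 s (Φ.adjoint x)‖ = ‖inner 𝕜 (Φ s) x‖ := by rw [LinearMap.adjoint_inner_right]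
      _ ≤ atomicNorm 𝕜 S (Φ s) * supportNorm 𝕜 S x := hS.norm_inner_le_atomicNorm_mul_supportNorm
      _ ≤ supportNorm 𝕜 S x :=
        mul_le_of_le_one_left supportNorm_nonneg (h s ▸ atomicNorm_le_one hs)

theorem atomicNorm_preserving_iff :
    (∀ x, atomicNorm 𝕜 S (Φ x) = atomicNorm 𝕜 S x) ↔ Φ '' S = S := by
  constructor
  · intro h
    have injective : Function.Injective Φ := (injective_iff_map_eq_zero Φ).2 fun x hx => by
      refine norm_le_zero_iff.1 (hS.norm_le_atomicNorm.trans ?_)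
      rw [← h, hx]
      simpa using atomicNorm_sum_le (𝕜 := 𝕜) (S := S) (N := 0) (a := nofun) nofun nofun
    obtain ⟨Φ, rfl⟩ : ∃ Φ' : E ≃ₗ[𝕜] E, Φ'.toLinearMap = Φ :=
      ⟨.ofInjectiveEndo Φ injective, by ext; simp⟩
    have hsymm (x : E) : atomicNorm 𝕜 S (Φ.symm.toLinearMap x) = atomicNorm 𝕜 S x := by
      simpa using (h (Φ.symm x)).symm
    rw [← LinearMap.adjoint_adjoint Φ.toLinearMap, ← hS.supportNorm_preserving_iff]
    refine fun x => (hS.supportNorm_adjoint_le h).antisymm ?_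
    calc supportNorm 𝕜 S x
        = supportNorm 𝕜 S (Φ.symm.toLinearMap.adjoint (Φ.toLinearMap.adjoint x)) := by
          rw [← LinearMap.comp_apply, ← LinearMap.adjoint_comp]; simp
      _ ≤ supportNorm 𝕜 S (Φ.toLinearMap.adjoint x) := hS.supportNorm_adjoint_le hsymm
  · intro h x
    have surjective : Function.Surjective Φ := by
      rw [← LinearMap.range_eq_top, ← top_le_iff, ← hS.span_eq_top, Submodule.span_le]
      exact h.symm.subset.trans (Set.image_subset_range _ _)
    obtain ⟨Φ, rfl⟩ : ∃ Φ' : E ≃ₗ[𝕜] E, Φ'.toLinearMap = Φ :=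
      ⟨.ofInjectiveEndo Φ (LinearMap.injective_iff_surjective.2 surjective), by ext; simp⟩
    have mapsTo_symm : Set.MapsTo Φ.symm.toLinearMap S S := by
      intro s hs
      obtain ⟨t, ht, rfl⟩ := h.symm.subset hs
      simpa using ht
    refine (hS.atomicNorm_map_le (Set.mapsTo_iff_image_subset.2 h.subset)).antisymm ?_
    simpa using hS.atomicNorm_map_le (x := Φ x) mapsTo_symm

end IsAtomSet
end AtomicNorm

section HilbertSchmidt

open Matrix
open scoped Matrix.Norms.Frobenius

variable {σ τ : Type*} [Fintype σ] [Fintype τ]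

theorem frobenius_norm_sq (X : Matrix σ τ ℂ) : ‖X‖ ^ 2 = ∑ i, ∑ j, ‖X i j‖ ^ 2 := by
  rw [frobenius_norm_def, ← Real.sqrt_eq_rpow, Real.sq_sqrt (by positivity)]
  simp

/-- The Hilbert–Schmidt inner product, whose norm is the Frobenius norm. -/
abbrev hilbertSchmidt : InnerProductSpace ℂ (Matrix σ τ ℂ) where
  inner X Y := (Xᴴ * Y).trace
  norm_sq_eq_re_inner X := by
    rw [frobenius_norm_sq, Finset.sum_comm]
    simp [trace, mul_apply, ← Complex.normSq_eq_conj_mul_self, Complex.normSq_eq_norm_sq,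
      -Complex.ofReal_pow]
  conj_inner_symm X Y := by
    rw [starRingEnd_apply, ← trace_conjTranspose, conjTranspose_mul, conjTranspose_conjTranspose]
  add_left X Y Z := by rw [conjTranspose_add, Matrix.add_mul, trace_add]
  smul_left X Y c := by simp

attribute [local instance] hilbertSchmidt

theorem hilbertSchmidt_inner (X Y : Matrix σ τ ℂ) : inner ℂ X Y = (Xᴴ * Y).trace := rfl

theorem norm_vecMulVec (v : EuclideanSpace ℂ σ) (w : EuclideanSpace ℂ τ) :
    ‖vecMulVec v.ofLp (star w.ofLp)‖ = ‖v‖ * ‖w‖ := by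
  rw [← sq_eq_sq₀ (by positivity) (by positivity), frobenius_norm_sq, mul_pow,
    EuclideanSpace.norm_sq_eq, EuclideanSpace.norm_sq_eq, Finset.sum_mul_sum]
  simp [vecMulVec_apply, mul_pow]

theorem inner_vecMulVec (v : EuclideanSpace ℂ σ) (w : EuclideanSpace ℂ τ) (X : Matrix σ τ ℂ) :
    inner ℂ (vecMulVec v.ofLp (star w.ofLp)) X = star v.ofLp ⬝ᵥ (X *ᵥ w.ofLp) := by
  rw [hilbertSchmidt_inner, conjTranspose_vecMulVec, star_star, vecMulVec_mul, trace_vecMulVec,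
    dotProduct_mulVec, dotProduct_comm]

end HilbertSchmidt

section PureOps

open Matrix Module

theorem exists_norm_eq_one_eq_smul {E : Type*} [NormedAddCommGroup E] [NormedSpace ℂ E]
    [Nontrivial E] (x : E) : ∃ (t : ℂ) (y : E), ‖y‖ = 1 ∧ x = t • y := by
  by_cases hx : x = 0
  · obtain ⟨y, hy⟩ := exists_norm_eq E zero_le_one
    exact ⟨0, y, hy, by simp [hx]⟩
  · have norm_ne_zero : (‖x‖ : ℂ) ≠ 0 := by simpa using hx
    exact ⟨‖x‖, (‖x‖ : ℂ)⁻¹ • x, norm_smul_inv_norm hx, (smul_inv_smul₀ norm_ne_zero x).symm⟩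

variable {m n k : ℕ}

theorem tensorVec_smul_smul (s t : ℂ) (a : EuclideanSpace ℂ (Fin m))
    (b : EuclideanSpace ℂ (Fin n)) : tensorVec (s • a) (t • b) = (s * t) • tensorVec a b := by
  ext p
  simp only [tensorVec, PiLp.smul_apply, smul_eq_mul]
  ring

theorem lowRank_iff_exists_sum_tensorVec {v : Vec m n} :
    LowRank k v.ofLp ↔ ∃ (a : Fin k → EuclideanSpace ℂ (Fin m))
      (b : Fin k → EuclideanSpace ℂ (Fin n)), v = ∑ l, tensorVec (a l) (b l) := by
  rw [lowRank_iff_exists_sum]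
  constructor
  · rintro ⟨a, b, hv⟩
    refine ⟨fun l => WithLp.toLp 2 (a l), fun l => WithLp.toLp 2 (b l), ?_⟩
    ext p
    simp [hv, tensorVec]
  · rintro ⟨a, b, rfl⟩
    exact ⟨fun l => a l, fun l => b l, by ext p; simp [tensorVec]⟩

theorem lowRank_iff_exists_isSeparable [NeZero m] [NeZero n] {v : Vec m n} :
    LowRank k v.ofLp ↔ ∃ (c : Fin k → ℂ) (u : Fin k → Vec m n),
      (∀ i, IsSeparable (u i)) ∧ v = ∑ i, c i • u i := by
  rw [lowRank_iff_exists_sum_tensorVec]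
  constructor
  · rintro ⟨a, b, rfl⟩
    choose s a' ha' ha using fun l => exists_norm_eq_one_eq_smul (a l)
    choose t b' hb' hb using fun l => exists_norm_eq_one_eq_smul (b l)
    exact ⟨fun l => s l * t l, fun l => tensorVec (a' l) (b' l),
      fun l => ⟨a' l, b' l, ha' l, hb' l, rfl⟩, by simp only [ha, hb, tensorVec_smul_smul]⟩
  · rintro ⟨c, u, hu, rfl⟩
    choose a b _ _ hab using hu
    refine ⟨fun l => c l • a l, b, Finset.sum_congr rfl fun l _ => ?_⟩
    simpa [hab] using (tensorVec_smul_smul (c l) 1 (a l) (b l)).symm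

theorem schmidtRank_le_iff [NeZero m] [NeZero n] {v : Vec m n} :
    schmidtRank v ≤ k ↔ LowRank k v.ofLp := by
  simp only [schmidtRank, ← lowRank_iff_exists_isSeparable]
  change sInf (Set.Ici (finrank ℂ (coeffMap v.ofLp).range)) ≤ k ↔ _
  rw [csInf_Ici, LowRank]

theorem isPureState_iff [NeZero m] [NeZero n] {v : Vec m n} :
    IsPureState k v ↔ ‖v‖ = 1 ∧ LowRank k v.ofLp := by
  rw [IsPureState, schmidtRank_le_iff]

theorem LowRank.star {v : Fin m × Fin n → ℂ} (h : LowRank k v) : LowRank k (star v) := by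
  rw [lowRank_iff_exists_sum] at *
  obtain ⟨a, b, rfl⟩ := h
  exact ⟨fun l => Star.star (a l), fun l => Star.star (b l), by ext p; simp⟩

variable (m n k) in
/-- The operators `|v⟩⟨w|` with `v`, `w` pure states of Schmidt rank at most `k`. -/
def pureOps : Set (Op m n) :=
  {X | ∃ v w : Vec m n, IsPureState k v ∧ IsPureState k w ∧ X = vecMulVec v.ofLp (star w.ofLp)}

open scoped Matrix.Norms.Frobenius
attribute [local instance] hilbertSchmidt

theorem skNorm_eq_supportNorm (X : Op m n) : skNorm k X = supportNorm ℂ (pureOps m n k) X := by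
  refine congrArg sSup (Set.ext fun r => ⟨?_, ?_⟩)
  · rintro ⟨v, w, hv, hw, rfl⟩
    exact ⟨_, ⟨v, w, hv, hw, rfl⟩, congrArg norm (inner_vecMulVec v w X)⟩
  · rintro ⟨_, ⟨v, w, hv, hw, rfl⟩, rfl⟩
    exact ⟨v, w, hv, hw, congrArg norm (inner_vecMulVec v w X)⟩

theorem gammaNorm_eq_atomicNorm (X : Op m n) : gammaNorm k X = atomicNorm ℂ (pureOps m n k) X := by
  refine congrArg sInf (Set.ext fun r => ⟨?_, ?_⟩)
  · rintro ⟨N, c, v, w, hv, hw, hX, hr⟩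
    exact ⟨N, c, _, fun i => ⟨v i, w i, hv i, hw i, rfl⟩, hX, hr⟩
  · rintro ⟨N, c, s, hs, hX, hr⟩
    choose v w hv hw hs using hs
    exact ⟨N, c, v, w, hv, hw, by simpa only [← hs] using hX, hr⟩

variable [NeZero m] [NeZero n]

theorem mem_pureOps_iff {X : Op m n} : X ∈ pureOps m n k ↔ LowRankOp k X ∧ ‖X‖ = 1 := by
  constructor
  · rintro ⟨v, w, hv, hw, rfl⟩
    rw [isPureState_iff] at hv hw
    exact ⟨⟨_, _, hv.2, hw.2.star, rfl⟩, by rw [norm_vecMulVec, hv.1, hw.1, mul_one]⟩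
  · rintro ⟨⟨v, w, hv, hw, rfl⟩, norm_eq⟩
    let v' : Vec m n := WithLp.toLp 2 v
    let w' : Vec m n := WithLp.toLp 2 (star w)
    have norm_mul : ‖v'‖ * ‖w'‖ = 1 := by
      rw [← norm_vecMulVec, ← norm_eq]; simp [v', w']
    have norm_ne_zero : (‖v'‖ : ℂ) ≠ 0 := by
      exact_mod_cast left_ne_zero_of_mul_eq_one norm_mul
    refine ⟨(‖v'‖ : ℂ)⁻¹ • v', (‖v'‖ : ℂ) • w', isPureState_iff.2 ⟨?_, hv.smul _⟩,
      isPureState_iff.2 ⟨?_, hw.star.smul _⟩, ?_⟩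
    · exact norm_smul_inv_norm (by simpa using norm_ne_zero)
    · simpa [norm_smul] using norm_mul
    · calc vecMulVec v w = ((‖v'‖ : ℂ)⁻¹ * ‖v'‖) • vecMulVec v w := by
            rw [inv_mul_cancel₀ norm_ne_zero, one_smul]
        _ = _ := by ext p q; simp [v', w', vecMulVec_apply]; ring

theorem isCompact_setOf_isPureState : IsCompact {v : Vec m n | IsPureState k v} := by
  have setOf_eq : {v : Vec m n | IsPureState k v} =
      Metric.sphere 0 1 ∩ WithLp.ofLp ⁻¹' {v | LowRank k v} := by
    ext v; simp [isPureState_iff]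
  rw [setOf_eq]
  exact (isCompact_sphere 0 1).inter_right
    (isClosed_setOf_lowRank.preimage (PiLp.continuous_ofLp 2 _))

theorem isCompact_pureOps : IsCompact (pureOps m n k) := by
  have eq_image : pureOps m n k =
      (fun p : Vec m n × Vec m n => vecMulVec p.1.ofLp (star p.2.ofLp)) ''
        ({v | IsPureState k v} ×ˢ {w | IsPureState k w}) := by
    ext X
    constructor
    · rintro ⟨v, w, hv, hw, rfl⟩
      exact ⟨(v, w), ⟨hv, hw⟩, rfl⟩
    · rintro ⟨⟨v, w⟩, ⟨hv, hw⟩, rfl⟩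
      exact ⟨v, w, hv, hw, rfl⟩
  rw [eq_image]
  exact (isCompact_setOf_isPureState.prod isCompact_setOf_isPureState).image (by fun_prop)

theorem single_mem_pureOps (hk : 1 ≤ k) (p q : Fin m × Fin n) :
    single p q 1 ∈ pureOps m n k := by
  have single_isPureState (p : Fin m × Fin n) : IsPureState k (EuclideanSpace.single p 1) := by
    exact isPureState_iff.2 ⟨by simp, (lowRank_one_single p).mono hk⟩
  refine ⟨_, _, single_isPureState p, single_isPureState q, ?_⟩
  rw [single_eq_single_vecMulVec_single]
  simp

theorem isAtomSet_pureOps (hk : 1 ≤ k) : IsAtomSet ℂ (pureOps m n k) where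
  isCompact := isCompact_pureOps
  span_eq_top := by
    rw [← top_le_iff, ← (stdBasis ℂ (Fin m × Fin n) (Fin m × Fin n)).span_eq]
    refine Submodule.span_mono ?_
    rintro _ ⟨⟨p, q⟩, rfl⟩
    rw [stdBasis_eq_single]
    exact single_mem_pureOps hk p q
  norm_eq_one hX := (mem_pureOps_iff.1 hX).2
  smul_mem := by
    rintro c _ hc ⟨v, w, hv, hw, rfl⟩
    rw [isPureState_iff] at hv
    exact ⟨c • v, w, isPureState_iff.2 ⟨by rw [norm_smul, hc, hv.1, one_mul], hv.2.smul c⟩, hw,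
      (smul_vecMulVec _ _ _).symm⟩

end PureOps

section LocalUnitary

open Matrix

variable {m n k : ℕ}

theorem swapOp_eq_permMatrix :
    (swapOp rfl : Op n n) = Equiv.Perm.permMatrix ℂ (Equiv.prodComm (Fin n) (Fin n)) := by
  ext p q
  rw [Equiv.Perm.permMatrix, PEquiv.toMatrix_toPEquiv_apply, swapOp, of_apply]
  simp [Prod.ext_iff, Pi.single_apply, and_comm, eq_comm]

theorem swapOp_mul (X : Op n n) : (swapOp rfl : Op n n) * X = X.submatrix Prod.swap id := by
  rw [swapOp_eq_permMatrix, PEquiv.toMatrix_toPEquiv_mul]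
  rfl

theorem mul_swapOp (X : Op n n) : X * (swapOp rfl : Op n n) = X.submatrix id Prod.swap := by
  rw [swapOp_eq_permMatrix, PEquiv.mul_toMatrix_toPEquiv]
  rfl

theorem swapOp_mulVec (v : Fin n × Fin n → ℂ) : swapOp rfl *ᵥ v = v ∘ Prod.swap := by
  rw [swapOp_eq_permMatrix, permMatrix_mulVec]
  rfl

theorem star_swapOp : star (swapOp rfl : Op n n) = swapOp rfl := by
  rw [swapOp_eq_permMatrix, star_eq_conjTranspose, conjTranspose_permMatrix]
  rfl

theorem swapOp_mul_swapOp : (swapOp rfl : Op n n) * swapOp rfl = 1 := by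
  rw [swapOp_eq_permMatrix, ← permMatrix_mul]
  exact permMatrix_one

theorem kronecker_mul_swapOp (A B : Matrix (Fin n) (Fin n) ℂ) :
    (A ⊗ₖ B : Op n n) * swapOp rfl = swapOp rfl * (B ⊗ₖ A) := by
  rw [mul_swapOp, swapOp_mul]
  ext p q
  exact mul_comm _ _

theorem isLocalUnitary_one : IsLocalUnitary (1 : Op m n) :=
  ⟨1, one_mem _, 1, one_mem _, Or.inl one_kronecker_one.symm⟩

theorem isLocalUnitary_swapOp : IsLocalUnitary (swapOp rfl : Op n n) :=
  ⟨1, one_mem _, 1, one_mem _, Or.inr ⟨rfl, by rw [one_kronecker_one, mul_one]⟩⟩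

theorem IsLocalUnitary.star {U : Op m n} (h : IsLocalUnitary U) : IsLocalUnitary (star U) := by
  obtain ⟨A, hA, B, hB, rfl | ⟨rfl, rfl⟩⟩ := h
  · exact ⟨_, Unitary.star_mem hA, _, Unitary.star_mem hB, Or.inl (conjTranspose_kronecker A B)⟩
  · refine ⟨_, Unitary.star_mem hB, _, Unitary.star_mem hA, Or.inr ⟨rfl, ?_⟩⟩
    rw [star_mul, star_swapOp, ← kronecker_mul_swapOp]
    exact congrArg (· * _) (conjTranspose_kronecker A B)

theorem IsLocalUnitary.mem_unitaryGroup {U : Op m n} (h : IsLocalUnitary U) :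
    U ∈ unitaryGroup (Fin m × Fin n) ℂ := by
  obtain ⟨A, hA, B, hB, rfl | ⟨rfl, rfl⟩⟩ := h
  · exact kronecker_mem_unitary hA hB
  · refine mul_mem ?_ (kronecker_mem_unitary hA hB)
    rw [mem_unitaryGroup_iff, star_swapOp, swapOp_mul_swapOp]

theorem kronecker_mulVec_mul (A : Matrix (Fin m) (Fin m) ℂ) (B : Matrix (Fin n) (Fin n) ℂ)
    (a : Fin m → ℂ) (b : Fin n → ℂ) :
    (A ⊗ₖ B) *ᵥ (fun p => a p.1 * b p.2) = fun p => (A *ᵥ a) p.1 * (B *ᵥ b) p.2 := by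
  ext p
  simp only [mulVec, dotProduct, kroneckerMap_apply, Fintype.sum_prod_type, Finset.sum_mul_sum]
  exact Finset.sum_congr rfl fun i _ => Finset.sum_congr rfl fun j _ => by ring

theorem LowRank.kronecker_mulVec {v : Fin m × Fin n → ℂ} (hv : LowRank k v)
    (A : Matrix (Fin m) (Fin m) ℂ) (B : Matrix (Fin n) (Fin n) ℂ) :
    LowRank k ((A ⊗ₖ B) *ᵥ v) := by
  rw [lowRank_iff_exists_sum] at *
  obtain ⟨a, b, rfl⟩ := hv
  refine ⟨fun l => A *ᵥ a l, fun l => B *ᵥ b l, ?_⟩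
  have sum_eq : (fun p : Fin m × Fin n => ∑ l, a l p.1 * b l p.2) =
      ∑ l, fun p : Fin m × Fin n => a l p.1 * b l p.2 := by ext; simp
  rw [sum_eq, mulVec_sum]
  ext p
  simp [kronecker_mulVec_mul]

theorem LowRank.comp_swap {v : Fin m × Fin n → ℂ} (hv : LowRank k v) :
    LowRank k (v ∘ Prod.swap) := by
  rw [lowRank_iff_exists_sum] at *
  obtain ⟨a, b, rfl⟩ := hv
  exact ⟨b, a, funext fun p => Finset.sum_congr rfl fun l _ => mul_comm _ _⟩

theorem IsLocalUnitary.lowRank_mulVec {U : Op m n} (h : IsLocalUnitary U)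
    {v : Fin m × Fin n → ℂ} (hv : LowRank k v) : LowRank k (U *ᵥ v) := by
  obtain ⟨A, -, B, -, rfl | ⟨rfl, rfl⟩⟩ := h
  · exact hv.kronecker_mulVec A B
  · rw [← mulVec_mulVec, swapOp_mulVec]
    exact (hv.kronecker_mulVec A B).comp_swap

end LocalUnitary

section Generators

open Matrix

variable {m n k : ℕ}

theorem IsLocalUnitary.lowRankOp_mul_mul {U V X : Op m n} (hU : IsLocalUnitary U)
    (hV : IsLocalUnitary V) (hX : LowRankOp k X) : LowRankOp k (U * X * V) := by
  obtain ⟨v, w, hv, hw, rfl⟩ := hX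
  refine ⟨U *ᵥ v, w ᵥ* V, hU.lowRank_mulVec hv, ?_, by rw [mul_vecMulVec, vecMulVec_mul]⟩
  rw [← star_star (w ᵥ* V), star_vecMul]
  exact (hV.star.lowRank_mulVec hw.star).star

theorem LowRankOp.partialTranspose {X : Op m n} (hX : LowRankOp 1 X) :
    LowRankOp 1 (partialTranspose X) := by
  obtain ⟨v, w, hv, hw, rfl⟩ := hX
  obtain ⟨a, b, rfl⟩ := lowRank_one_iff.1 hv
  obtain ⟨c, d, rfl⟩ := lowRank_one_iff.1 hw
  refine ⟨fun p => a p.1 * d p.2, fun p => c p.1 * b p.2, lowRank_one_iff.2 ⟨a, d, rfl⟩,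
    lowRank_one_iff.2 ⟨c, b, rfl⟩, ?_⟩
  ext p q
  simp only [EntNorm.partialTranspose, of_apply, vecMulVec_apply]
  ring

theorem lowRankOp_of_mem_closure {Φ : Module.End ℂ (Op m n)}
    (hΦ : Φ ∈ Subsemigroup.closure (generators m n k)) {X : Op m n} (hX : LowRankOp k X) :
    LowRankOp k (Φ X) := by
  induction hΦ using Subsemigroup.closure_induction generalizing X with
  | mem _ hΦ =>
    rcases hΦ with ⟨U, V, hU, hV, h⟩ | h | ⟨rfl, h⟩ <;> rw [h]
    exacts [hU.lowRankOp_mul_mul hV hX, hX.transpose, hX.partialTranspose]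
  | mul _ _ _ _ ihΦ ihΨ => exact ihΦ (ihΨ hX)

open scoped Matrix.Norms.Frobenius
attribute [local instance] hilbertSchmidt

theorem inner_transpose_left (X Y : Op m n) : inner ℂ Xᵀ Y = inner ℂ X Yᵀ := by
  rw [hilbertSchmidt_inner, hilbertSchmidt_inner, ← trace_transpose, transpose_mul,
    trace_mul_comm]
  rfl

theorem inner_partialTranspose_left (X Y : Op m n) :
    inner ℂ (partialTranspose X) Y = inner ℂ X (partialTranspose Y) := by
  simp only [hilbertSchmidt_inner, trace, diag_apply, mul_apply, conjTranspose_apply,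
    partialTranspose, of_apply, Fintype.sum_prod_type]
  refine Finset.sum_congr rfl fun i _ => ?_
  rw [Finset.sum_comm, Finset.sum_comm (s := Finset.univ (α := Fin n))]
  exact Finset.sum_congr rfl fun r _ => Finset.sum_comm

theorem inner_mul_mul_left (U V X Y : Op m n) :
    inner ℂ (star U * X * star V) Y = inner ℂ X (U * Y * V) := by
  rw [hilbertSchmidt_inner, hilbertSchmidt_inner, ← star_eq_conjTranspose, star_mul, star_mul,
    star_star, star_star, mul_assoc V, trace_mul_comm V, star_eq_conjTranspose]
  simp only [mul_assoc]

theorem mem_generators_star {Φ : Module.End ℂ (Op m n)} (hΦ : Φ ∈ generators m n k) :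
    star Φ ∈ generators m n k ∧ star Φ * Φ = 1 := by
  obtain ⟨Ψ, hΨ, inner_eq, mul_eq⟩ : ∃ Ψ ∈ generators m n k,
      (∀ X Y, inner ℂ (Ψ X) Y = inner ℂ X (Φ Y)) ∧ ∀ X, Ψ (Φ X) = X := by
    rcases hΦ with ⟨U, V, hU, hV, h⟩ | h | ⟨hk, h⟩
    · refine ⟨LinearMap.mulLeftRight ℂ (star U, star V),
        Or.inl ⟨_, _, hU.star, hV.star, fun _ => LinearMap.mulLeftRight_apply ..⟩,
        fun X Y => ?_, fun X => ?_⟩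
      · rw [h, LinearMap.mulLeftRight_apply, inner_mul_mul_left]
      · rw [h, LinearMap.mulLeftRight_apply, mul_assoc U, ← mul_assoc (star U),
          mem_unitaryGroup_iff'.1 hU.mem_unitaryGroup, one_mul, mul_assoc,
          mem_unitaryGroup_iff.1 hV.mem_unitaryGroup, mul_one]
    · exact ⟨Φ, Or.inr (Or.inl h), fun X Y => by rw [h, h, inner_transpose_left],
        fun X => by rw [h, h, transpose_transpose]⟩
    · exact ⟨Φ, Or.inr (Or.inr ⟨hk, h⟩), fun X Y => by rw [h, h, inner_partialTranspose_left],
        fun X => by rw [h, h]; rfl⟩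
  have star_eq : star Φ = Ψ := ((LinearMap.eq_adjoint_iff Ψ Φ).2 inner_eq).symm
  rw [star_eq]
  exact ⟨hΨ, LinearMap.ext mul_eq⟩

theorem star_mem_closure_generators {Φ : Module.End ℂ (Op m n)}
    (hΦ : Φ ∈ Subsemigroup.closure (generators m n k)) :
    star Φ ∈ Subsemigroup.closure (generators m n k) := by
  induction hΦ using Subsemigroup.closure_induction with
  | mem Φ hΦ => exact Subsemigroup.subset_closure (mem_generators_star hΦ).1
  | mul Φ Ψ _ _ ihΦ ihΨ => rw [star_mul]; exact mul_mem ihΨ ihΦ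

theorem mem_unitary_of_mem_closure_generators {Φ : Module.End ℂ (Op m n)}
    (hΦ : Φ ∈ Subsemigroup.closure (generators m n k)) :
    Φ ∈ unitary (Module.End ℂ (Op m n)) := by
  induction hΦ using Subsemigroup.closure_induction with
  | mem Φ hΦ =>
    obtain ⟨star_mem, star_mul_self⟩ := mem_generators_star hΦ
    exact ⟨star_mul_self, by simpa using (mem_generators_star star_mem).2⟩
  | mul Φ Ψ _ _ ihΦ ihΨ => exact mul_mem ihΦ ihΨ

theorem norm_map_of_mem_unitary {E : Type*} [NormedAddCommGroup E] [InnerProductSpace ℂ E]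
    [FiniteDimensional ℂ E] {Φ : Module.End ℂ E} (hΦ : Φ ∈ unitary (Module.End ℂ E)) (x : E) :
    ‖Φ x‖ = ‖x‖ := by
  have inner_eq : inner ℂ (Φ x) (Φ x) = inner ℂ x x := by
    rw [← LinearMap.adjoint_inner_right]
    exact congrArg (inner ℂ x) (LinearMap.congr_fun hΦ.1 x)
  rw [norm_eq_sqrt_re_inner (𝕜 := ℂ), inner_eq, ← norm_eq_sqrt_re_inner]

theorem image_pureOps_of_mem_closure_generators [NeZero m] [NeZero n] {Φ : Module.End ℂ (Op m n)}
    (hΦ : Φ ∈ Subsemigroup.closure (generators m n k)) :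
    Φ '' pureOps m n k = pureOps m n k := by
  have mapsTo {Ψ : Module.End ℂ (Op m n)} (hΨ : Ψ ∈ Subsemigroup.closure (generators m n k)) :
      Set.MapsTo Ψ (pureOps m n k) (pureOps m n k) := fun X hX => by
    rw [mem_pureOps_iff] at *
    exact ⟨lowRankOp_of_mem_closure hΨ hX.1,
      (norm_map_of_mem_unitary (mem_unitary_of_mem_closure_generators hΨ) X).trans hX.2⟩
  refine (mapsTo hΦ).image_subset.antisymm fun X hX => ?_
  exact ⟨star Φ X, mapsTo (star_mem_closure_generators hΦ) hX,
    LinearMap.congr_fun (mem_unitary_of_mem_closure_generators hΦ).2 X⟩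

end Generators

section Legs

open Matrix

variable {m n k : ℕ}

/-- The dimensions of the four tensor factors of `M_m ⊗ M_n = ℂ^m ⊗ ℂ^n ⊗ (ℂ^m)* ⊗ (ℂ^n)*`, called
its legs. -/
def legDim (m n : ℕ) : Fin 4 → ℕ
  | 0 => m
  | 1 => n
  | 2 => m
  | 3 => n

theorem legDim_eq_iff (hmn : m ≠ n) (i j : Fin 4) :
    legDim m n i = legDim m n j ↔ i.val % 2 = j.val % 2 := by
  fin_cases i <;> fin_cases j <;> simp [legDim, hmn, hmn.symm]

/-- The operator `(a ⊗ b) (c ⊗ d)ᵀ` for the family `x` of the four vectors `a`, `b`, `c`, `d`. -/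
def legOp (x : ∀ l, Fin (legDim m n l) → ℂ) : Op m n :=
  vecMulVec (fun p => x 0 p.1 * x 1 p.2) fun p => x 2 p.1 * x 3 p.2

/-- The family of four vectors with the given members. -/
def legVecs (a : Fin m → ℂ) (b : Fin n → ℂ) (c : Fin m → ℂ) (d : Fin n → ℂ) :
    ∀ l, Fin (legDim m n l) → ℂ
  | 0 => a
  | 1 => b
  | 2 => c
  | 3 => d

variable (m n) in
/-- Operators as tensors with four legs, indexed by multi-indices. -/
def toTensor : Op m n ≃ₗ[ℂ] ((∀ l, Fin (legDim m n l)) → ℂ) where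
  toFun X J := X (J 0, J 1) (J 2, J 3)
  invFun T := Matrix.of fun p q => T fun
    | 0 => p.1
    | 1 => p.2
    | 2 => q.1
    | 3 => q.2
  map_add' _ _ := rfl
  map_smul' _ _ := rfl
  left_inv _ := rfl
  right_inv T := by
    funext J
    exact congrArg T (funext fun l => by fin_cases l <;> rfl)

theorem toTensor_legOp (x : ∀ l, Fin (legDim m n l) → ℂ) :
    toTensor m n (legOp x) = prodTensor x := by
  funext J
  rw [prodTensor_apply, Fin.prod_univ_four, mul_assoc]
  rfl

theorem toTensor_symm_prodTensor (x : ∀ l, Fin (legDim m n l) → ℂ) :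
    (toTensor m n).symm (prodTensor x) = legOp x := by
  rw [LinearEquiv.symm_apply_eq, toTensor_legOp]

theorem lowRankOp_one_iff {X : Op m n} : LowRankOp 1 X ↔ X ∈ Set.range legOp := by
  constructor
  · rintro ⟨v, w, hv, hw, rfl⟩
    obtain ⟨a, b, rfl⟩ := lowRank_one_iff.1 hv
    obtain ⟨c, d, rfl⟩ := lowRank_one_iff.1 hw
    exact ⟨legVecs a b c d, rfl⟩
  · rintro ⟨x, rfl⟩
    exact ⟨_, _, lowRank_one_iff.2 ⟨x 0, x 1, rfl⟩, lowRank_one_iff.2 ⟨x 2, x 3, rfl⟩, rfl⟩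

theorem toTensor_mem_range_prodTensor_iff {X : Op m n} :
    toTensor m n X ∈ Set.range (prodTensor : (∀ l, Fin (legDim m n l) → ℂ) → _) ↔
      LowRankOp 1 X := by
  simp only [lowRankOp_one_iff, Set.mem_range, ← toTensor_legOp, EmbeddingLike.apply_eq_iff_eq]

theorem linearMap_ext_legOp {Φ Ψ : Module.End ℂ (Op m n)} (h : ∀ x, Φ (legOp x) = Ψ (legOp x)) :
    Φ = Ψ := by
  have comp_eq : Φ ∘ₗ (toTensor m n).symm.toLinearMap = Ψ ∘ₗ (toTensor m n).symm.toLinearMap :=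
    LinearMap.pi_ext' fun J => LinearMap.ext_ring <| by
      simp [← prodTensor_single_one, toTensor_symm_prodTensor, h]
  ext1 X
  simpa using LinearMap.congr_fun comp_eq (toTensor m n X)

open scoped Matrix.Norms.Frobenius in
theorem norm_legOp (x : ∀ l, Fin (legDim m n l) → ℂ) :
    ‖legOp x‖ = ∏ l, ‖WithLp.toLp 2 (x l)‖ := by
  rw [← sq_eq_sq₀ (by positivity) (by positivity), frobenius_norm_sq, ← Finset.prod_pow]
  simp only [EuclideanSpace.norm_sq_eq, Fin.prod_univ_four, legOp, vecMulVec_apply, norm_mul,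
    mul_pow, Fintype.sum_prod_type, ← Finset.mul_sum, ← Finset.sum_mul, mul_assoc]
  rfl

end Legs

section ActsAs

open Matrix

variable {m n : ℕ} {Φ Ψ : Module.End ℂ (Op m n)} {ρ τ : Equiv.Perm (Fin 4)}

/-- The map `Φ` permutes the legs by `ρ` and acts linearly and injectively on each of them. -/
def ActsAs (Φ : Module.End ℂ (Op m n)) (ρ : Equiv.Perm (Fin 4)) : Prop :=
  ∃ A : ∀ j, (Fin (legDim m n (ρ j)) → ℂ) →ₗ[ℂ] (Fin (legDim m n j) → ℂ),
    (∀ j, Function.Injective (A j)) ∧ ∀ x, Φ (legOp x) = legOp fun j => A j (x (ρ j))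

theorem ActsAs.mul (hΦ : ActsAs Φ ρ) (hΨ : ActsAs Ψ τ) : ActsAs (Ψ * Φ) (ρ * τ) := by
  obtain ⟨A, hA, hΦ⟩ := hΦ
  obtain ⟨B, hB, hΨ⟩ := hΨ
  exact ⟨fun j => B j ∘ₗ A (τ j), fun j => (hB j).comp (hA (τ j)), fun x =>
    (congrArg Ψ (hΦ x)).trans (hΨ _)⟩

theorem exists_actsAs (hm : 2 ≤ m) (hn : 2 ≤ n) {Φ : Op m n ≃ₗ[ℂ] Op m n}
    (h : ∀ X, LowRankOp 1 (Φ X) ↔ LowRankOp 1 X) : ∃ ρ, ActsAs Φ.toLinearMap ρ := by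
  have : ∀ l, Nontrivial (Fin (legDim m n l)) := fun l =>
    Fin.nontrivial_iff_two_le.2 (by fin_cases l <;> assumption)
  have preserves : PreservesElementary ((toTensor m n).symm ≪≫ₗ Φ ≪≫ₗ toTensor m n) := fun T => by
    obtain ⟨X, rfl⟩ := (toTensor m n).surjective T
    simp only [LinearEquiv.trans_apply, LinearEquiv.symm_apply_apply,
      toTensor_mem_range_prodTensor_iff, h]
  obtain ⟨ρ, A, hA, hΦ⟩ := preserves.exists_map_eq
  refine ⟨ρ, A, hA, fun x => (toTensor m n).injective ?_⟩
  rw [toTensor_legOp, ← hΦ]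
  simp [toTensor_symm_prodTensor]

theorem ActsAs.legDim_eq (h : ActsAs Φ ρ) (j : Fin 4) : legDim m n (ρ j) = legDim m n j := by
  obtain ⟨A, hA, -⟩ := h
  have legDim_le : ∀ j ∈ Finset.univ, legDim m n (ρ j) ≤ legDim m n j := fun j _ => by
    simpa using LinearMap.finrank_le_finrank_of_injective (hA j)
  exact (Finset.sum_eq_sum_iff_of_le legDim_le).1 (Equiv.sum_comp ρ _) j (Finset.mem_univ j)

theorem actsAs_of_legDim_eq (hρ : ∀ j, legDim m n (ρ j) = legDim m n j)
    (h : ∀ x, Φ (legOp x) = legOp fun j => x (ρ j) ∘ Fin.cast (hρ j).symm) : ActsAs Φ ρ :=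
  ⟨fun j => LinearMap.funLeft ℂ ℂ (Fin.cast (hρ j).symm), fun j =>
    LinearMap.funLeft_injective_of_surjective _ _ _ (finCongr (hρ j).symm).surjective, h⟩

theorem actsAs_one : ActsAs (1 : Module.End ℂ (Op m n)) 1 :=
  actsAs_of_legDim_eq (fun _ => rfl) fun _ => rfl

theorem actsAs_transpose (h : ∀ X, Φ X = Xᵀ) : ActsAs Φ (Equiv.swap 0 2 * Equiv.swap 1 3) := by
  refine actsAs_of_legDim_eq (fun j => by fin_cases j <;> rfl) fun x => ?_
  rw [h]
  exact transpose_vecMulVec _ _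

theorem actsAs_partialTranspose (h : ∀ X, Φ X = partialTranspose X) :
    ActsAs Φ (Equiv.swap 1 3) := by
  refine actsAs_of_legDim_eq (fun j => by fin_cases j <;> rfl) fun x => ?_
  rw [h]
  ext p q
  change x 0 p.1 * x 1 q.2 * (x 2 q.1 * x 3 p.2) = x 0 p.1 * x 3 p.2 * (x 2 q.1 * x 1 q.2)
  ring

theorem actsAs_mulLeft_swapOp :
    ActsAs (LinearMap.mulLeft ℂ (swapOp rfl : Op n n)) (Equiv.swap 0 1) := by
  refine actsAs_of_legDim_eq (fun j => by fin_cases j <;> rfl) fun x => ?_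
  rw [LinearMap.mulLeft_apply, swapOp_mul]
  ext p q
  exact congrArg (· * (x 2 q.1 * x 3 q.2)) (mul_comm (x 0 p.2) (x 1 p.1))

theorem actsAs_mulRight_swapOp :
    ActsAs (LinearMap.mulRight ℂ (swapOp rfl : Op n n)) (Equiv.swap 2 3) := by
  refine actsAs_of_legDim_eq (fun j => by fin_cases j <;> rfl) fun x => ?_
  rw [LinearMap.mulRight_apply, mul_swapOp]
  ext p q
  exact congrArg (x 0 p.1 * x 1 p.2 * ·) (mul_comm (x 2 q.2) (x 3 q.1))

end ActsAs

section RealizedPerms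

open Matrix Equiv

variable {m n k : ℕ} {Φ : Module.End ℂ (Op m n)} {ρ : Perm (Fin 4)}

variable (m n k) in
/-- The permutations of the legs realized by compositions of the generators. -/
def realizedPerms : Submonoid (Perm (Fin 4)) where
  carrier := {ρ | ∃ Φ ∈ Subsemigroup.closure (generators m n k), ActsAs Φ ρ}
  one_mem' := ⟨1, Subsemigroup.subset_closure
    (Or.inl ⟨1, 1, isLocalUnitary_one, isLocalUnitary_one, fun X => by simp⟩), actsAs_one⟩
  mul_mem' := by
    rintro ρ τ ⟨Φ, hΦ, hρ⟩ ⟨Ψ, hΨ, hτ⟩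
    exact ⟨Ψ * Φ, mul_mem hΨ hΦ, hρ.mul hτ⟩

theorem mem_realizedPerms_of_generator (hΦ : Φ ∈ generators m n k) (hρ : ActsAs Φ ρ) :
    ρ ∈ realizedPerms m n k :=
  ⟨Φ, Subsemigroup.subset_closure hΦ, hρ⟩

theorem swap_zero_two_mul_swap_one_three_mem_realizedPerms :
    swap 0 2 * swap 1 3 ∈ realizedPerms m n k :=
  mem_realizedPerms_of_generator (Φ := (transposeLinearEquiv _ _ ℂ ℂ).toLinearMap)
    (Or.inr (Or.inl fun _ => rfl)) (actsAs_transpose fun _ => rfl)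

theorem swap_zero_one_mem_realizedPerms : swap 0 1 ∈ realizedPerms n n k :=
  mem_realizedPerms_of_generator
    (Or.inl ⟨_, 1, isLocalUnitary_swapOp, isLocalUnitary_one, fun X => by simp⟩)
    actsAs_mulLeft_swapOp

theorem swap_two_three_mem_realizedPerms : swap 2 3 ∈ realizedPerms n n k :=
  mem_realizedPerms_of_generator
    (Or.inl ⟨1, _, isLocalUnitary_one, isLocalUnitary_swapOp, fun X => by simp⟩)
    actsAs_mulRight_swapOp

theorem swap_one_three_mem_realizedPerms : swap 1 3 ∈ realizedPerms m n 1 :=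
  mem_realizedPerms_of_generator
    (Φ := { toFun := partialTranspose, map_add' := fun _ _ => rfl, map_smul' := fun _ _ => rfl })
    (Or.inr (Or.inr ⟨rfl, fun _ => rfl⟩)) (actsAs_partialTranspose fun _ => rfl)

-- The swaps `(0 1)`, `(2 3)` and `(0 2)(1 3)` generate the dihedral group of order eight, which
-- has two double cosets in the symmetric group on the legs.
theorem exists_swap_pow_mul_mul_swap_pow_eq (ρ : Perm (Fin 4)) :
    ∃ a b c d : Fin 2, swap 0 1 ^ a.val * swap 2 3 ^ b.val * (swap 0 2 * swap 1 3) ^ c.val * ρ *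
      swap 0 1 ^ d.val ∈ ({1, swap 1 3} : Finset (Perm (Fin 4))) := by
  revert ρ
  decide +kernel

theorem exists_swap_pow_mul_eq_of_mod_two (h : ∀ j, (ρ j).val % 2 = j.val % 2) :
    ∃ c : Fin 2, (swap 0 2 * swap 1 3) ^ c.val * ρ ∈ ({1, swap 1 3} : Finset (Perm (Fin 4))) := by
  revert ρ
  decide +kernel

theorem ActsAs.exists_mul_mul_eq (h : ActsAs Φ ρ) : ∃ τ ∈ realizedPerms m n k,
    ∃ τ' ∈ realizedPerms m n k, τ * ρ * τ' ∈ ({1, swap 1 3} : Finset (Perm (Fin 4))) := by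
  have transpose_mem := @swap_zero_two_mul_swap_one_three_mem_realizedPerms m n k
  by_cases hmn : m = n
  · subst hmn
    obtain ⟨a, b, c, d, mem⟩ := exists_swap_pow_mul_mul_swap_pow_eq ρ
    have left_mem := @swap_zero_one_mem_realizedPerms m k
    have right_mem := @swap_two_three_mem_realizedPerms m k
    exact ⟨_, mul_mem (mul_mem (pow_mem left_mem a) (pow_mem right_mem b))
      (pow_mem transpose_mem c), _, pow_mem left_mem d, mem⟩
  · obtain ⟨c, mem⟩ := exists_swap_pow_mul_eq_of_mod_two fun j =>
      (legDim_eq_iff hmn _ _).1 (h.legDim_eq j)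
    exact ⟨_, pow_mem transpose_mem c, 1, one_mem _, by rwa [mul_one]⟩

end RealizedPerms

section PartialTranspose

open Matrix Equiv

variable {m n k : ℕ} {Φ : Module.End ℂ (Op m n)}

theorem legOp_legVecs_single (i r : Fin m) (j s : Fin n) :
    legOp (legVecs (Pi.single i 1) (Pi.single j 1) (Pi.single r 1) (Pi.single s 1)) =
      single (i, j) (r, s) 1 := by
  rw [single_eq_single_vecMulVec_single, single_prod_eq_mul, single_prod_eq_mul]
  rfl

theorem ActsAs.exists_map_single (h : ActsAs Φ (swap 1 3)) :
    ∃ u w : Fin m → Fin n → Fin m × Fin n → ℂ,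
      ∀ i j r s, Φ (single (i, j) (r, s) 1) = vecMulVec (u i s) (w r j) := by
  obtain ⟨A, -, hA⟩ := h
  refine ⟨fun i s p => A 0 (Pi.single i 1 : Fin m → ℂ) p.1 * A 1 (Pi.single s 1 : Fin n → ℂ) p.2,
    fun r j p => A 2 (Pi.single r 1 : Fin m → ℂ) p.1 * A 3 (Pi.single j 1 : Fin n → ℂ) p.2,
    fun i j r s => ?_⟩
  rw [← legOp_legVecs_single, hA]
  rfl

theorem single_ne_smul_single {σ : Type*} [DecidableEq σ] {p p' q q' : σ} (hp : p ≠ p') (c : ℂ) :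
    single p q (1 : ℂ) ≠ c • single p' q' 1 := fun h => by
  simpa [single_apply, hp.symm] using congrFun (congrFun h p) q

-- The operator `(e₁ ⊗ e₁ + e₀ ⊗ e₀) (e₀ ⊗ e₀)ᵀ` has Schmidt rank at most two, but its partial
-- transpose has rank two as a matrix.
theorem not_actsAs_swap_one_three [Nontrivial (Fin m)] [Nontrivial (Fin n)]
    (hΦ : Function.Injective Φ) (h : ∀ X, LowRankOp 2 X → LowRankOp k (Φ X)) :
    ¬ ActsAs Φ (swap 1 3) := fun hswap => by
  obtain ⟨u, w, map_single⟩ := hswap.exists_map_single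
  obtain ⟨i₀, i₁, hi⟩ := exists_pair_ne (Fin m)
  obtain ⟨j₀, j₁, hj⟩ := exists_pair_ne (Fin n)
  have map_ne (c : ℂ) {p : Fin m × Fin n} (hp : p ≠ (i₀, j₀)) :
      Φ (single p (i₀, j₀) 1) ≠ c • Φ (single (i₀, j₀) (i₀, j₀) 1) := fun h =>
    single_ne_smul_single hp c (hΦ (by rw [h, map_smul]))
  have vecMulVec_ne_zero : vecMulVec (u i₀ j₀) (w i₀ j₀) ≠ 0 := by
    rw [← map_single, map_ne_zero_iff Φ hΦ]
    exact fun h => by simpa using congrFun (congrFun h (i₀, j₀)) (i₀, j₀)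
  have lowRankOp_two : LowRankOp 2
      (single (i₁, j₁) (i₀, j₀) 1 + single (i₀, j₀) (i₀, j₀) 1 : Op m n) := by
    refine ⟨Pi.single (i₁, j₁) 1 + Pi.single (i₀, j₀) 1, Pi.single (i₀, j₀) 1,
      lowRank_iff_exists_sum.2 ⟨![Pi.single i₁ 1, Pi.single i₀ 1],
        ![Pi.single j₁ 1, Pi.single j₀ 1], ?_⟩,
      (lowRank_one_single _).mono one_le_two, ?_⟩
    · ext p
      simp [single_prod_eq_mul]
    · rw [add_vecMulVec, ← single_eq_single_vecMulVec_single, ← single_eq_single_vecMulVec_single]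
  obtain ⟨p, q, -, -, map_eq⟩ := h _ lowRankOp_two
  rw [map_add, map_single, map_single] at map_eq
  obtain ⟨c, hc⟩ | ⟨c, hc⟩ := exists_eq_smul_of_vecMulVec_add_eq
    (fun h => vecMulVec_ne_zero (by rw [h, zero_vecMulVec]))
    (fun h => vecMulVec_ne_zero (by rw [h, vecMulVec_zero])) map_eq
  · exact map_ne c (p := (i₁, j₀)) (by simp [hi.symm])
      (by rw [map_single, map_single, hc, smul_vecMulVec])
  · exact map_ne c (p := (i₀, j₁)) (by simp [hj.symm])
      (by rw [map_single, map_single, hc, vecMulVec_smul])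

end PartialTranspose

theorem eq_mul_of_prod_eq {ι M : Type*} [Fintype ι] [CommMonoid M] {α : ι → Type*}
    {f g : ∀ i, α i → M} (x₀ : ∀ i, α i) (hx₀ : ∀ i, g i (x₀ i) = 1)
    (h : ∀ x : ∀ i, α i, ∏ i, f i (x i) = ∏ i, g i (x i)) (i : ι) (a : α i) :
    f i a = f i (x₀ i) * g i a := by
  classical
  have prod_update (F : ∀ i, α i → M) : ∏ j, F j (Function.update x₀ i a j) =
      F i a * ∏ j ∈ Finset.univ.erase i, F j (x₀ j) := by
    rw [← Finset.mul_prod_erase _ _ (Finset.mem_univ i), Function.update_self]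
    exact congrArg _ (Finset.prod_congr rfl fun j hj => by
      rw [Function.update_of_ne (Finset.ne_of_mem_erase hj)])
  have prod_eq_one : f i (x₀ i) * ∏ j ∈ Finset.univ.erase i, f j (x₀ j) = 1 := by
    rw [Finset.mul_prod_erase _ (fun j => f j (x₀ j)) (Finset.mem_univ i), h]
    exact Finset.prod_eq_one fun j _ => hx₀ j
  have f_mul_eq : f i a * ∏ j ∈ Finset.univ.erase i, f j (x₀ j) = g i a := by
    rw [← prod_update f, h, prod_update g, Finset.prod_eq_one fun j _ => hx₀ j, mul_one]
  rw [← f_mul_eq, mul_left_comm, prod_eq_one, mul_one]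

section LocalUnitary

open Matrix

theorem mem_unitaryGroup_of_norm_mulVec {σ : Type*} [Fintype σ] [DecidableEq σ]
    {U : Matrix σ σ ℂ} (h : ∀ v, ‖WithLp.toLp 2 (U *ᵥ v)‖ = ‖WithLp.toLp 2 v‖) :
    U ∈ unitaryGroup σ ℂ := by
  rw [mem_unitaryGroup_iff', ← EmbeddingLike.apply_eq_iff_eq (toEuclideanCLM (𝕜 := ℂ)),
    map_mul, map_star, map_one]
  exact (ContinuousLinearMap.norm_map_iff_adjoint_comp_self _).1 fun v => h v.ofLp

variable {m n k : ℕ} {Φ : Module.End ℂ (Op m n)}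

theorem legOp_smul (c : Fin 4 → ℂ) (x : ∀ l, Fin (legDim m n l) → ℂ) :
    legOp (fun l => c l • x l) = (∏ l, c l) • legOp x := by
  apply (toTensor m n).injective
  rw [map_smul, toTensor_legOp, toTensor_legOp, MultilinearMap.map_smul_univ]

theorem kronecker_mul_legOp_mul
    (A : ∀ l, Matrix (Fin (legDim m n l)) (Fin (legDim m n l)) ℂ)
    (x : ∀ l, Fin (legDim m n l) → ℂ) :
    (A 0 ⊗ₖ A 1 : Op m n) * legOp x * ((A 2)ᵀ ⊗ₖ (A 3)ᵀ : Op m n) =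
      legOp fun l => A l *ᵥ x l := by
  have transpose_eq : ((A 2)ᵀ ⊗ₖ (A 3)ᵀ : Op m n) = (A 2 ⊗ₖ A 3 : Op m n)ᵀ := rfl
  rw [transpose_eq, legOp, mul_vecMulVec, vecMulVec_mul, vecMul_transpose]
  exact congrArg₂ vecMulVec (kronecker_mulVec_mul (A 0) (A 1) (x 0) (x 1))
    (kronecker_mulVec_mul (A 2) (A 3) (x 2) (x 3))

section

open scoped Matrix.Norms.Frobenius

variable [NeZero m] [NeZero n]

-- The factors of `Φ` scale the norms of vectors by constants with product one, so dividing by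
-- these constants makes them unitary.
theorem ActsAs.exists_unitary (h : ActsAs Φ 1) (norm_map : ∀ x, ‖Φ (legOp x)‖ = ‖legOp x‖) :
    ∃ U : ∀ l, Matrix (Fin (legDim m n l)) (Fin (legDim m n l)) ℂ,
      (∀ l, U l ∈ unitaryGroup _ ℂ) ∧ ∀ x, Φ (legOp x) = legOp fun l => U l *ᵥ x l := by
  obtain ⟨A, hA⟩ : ∃ A : ∀ l, (Fin (legDim m n l) → ℂ) →ₗ[ℂ] Fin (legDim m n l) → ℂ,
      ∀ x, Φ (legOp x) = legOp fun l => A l (x l) :=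
    let ⟨A, _, hA⟩ := h
    ⟨A, hA⟩
  let x₀ : ∀ l, Fin (legDim m n l) → ℂ :=
    legVecs (Pi.single 0 1) (Pi.single 0 1) (Pi.single 0 1) (Pi.single 0 1)
  have norm_x₀ (l) : ‖WithLp.toLp 2 (x₀ l)‖ = 1 := by
    fin_cases l <;> exact (PiLp.norm_single 2 _ _ _).trans norm_one
  let r (l : Fin 4) : ℝ := ‖WithLp.toLp 2 (A l (x₀ l))‖
  have prod_norm_eq (x : ∀ l, Fin (legDim m n l) → ℂ) :
      ∏ l, ‖WithLp.toLp 2 (A l (x l))‖ = ∏ l, ‖WithLp.toLp 2 (x l)‖ := by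
    rw [← norm_legOp x, ← norm_map, hA, norm_legOp]
  have norm_A (l) (v : Fin (legDim m n l) → ℂ) :
      ‖WithLp.toLp 2 (A l v)‖ = r l * ‖WithLp.toLp 2 v‖ :=
    eq_mul_of_prod_eq (f := fun l (v : Fin (legDim m n l) → ℂ) => ‖WithLp.toLp 2 (A l v)‖)
      (g := fun l v => ‖WithLp.toLp 2 v‖) x₀ norm_x₀ prod_norm_eq l v
  have prod_r : ∏ l, r l = 1 := (prod_norm_eq x₀).trans (Finset.prod_eq_one fun l _ => norm_x₀ l)
  have r_ne_zero (l) : r l ≠ 0 :=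
    Finset.prod_ne_zero_iff.1 (prod_r ▸ one_ne_zero) l (Finset.mem_univ l)
  refine ⟨fun l => (r l : ℂ)⁻¹ • LinearMap.toMatrix' (A l),
    fun l => mem_unitaryGroup_of_norm_mulVec fun v => ?_, fun x => ?_⟩
  · rw [smul_mulVec, LinearMap.toMatrix'_mulVec, WithLp.toLp_smul, norm_smul, norm_inv,
      Complex.norm_real, norm_A, norm_norm, inv_mul_cancel_left₀ (r_ne_zero l)]
  · simp only [hA, smul_mulVec, LinearMap.toMatrix'_mulVec]
    rw [legOp_smul, Finset.prod_inv_distrib, ← Complex.ofReal_prod, prod_r, Complex.ofReal_one,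
      inv_one, one_smul]

theorem ActsAs.mem_closure_generators (h : ActsAs Φ 1)
    (norm_map : ∀ x, ‖Φ (legOp x)‖ = ‖legOp x‖) : Φ ∈ Subsemigroup.closure (generators m n k) := by
  obtain ⟨U, hU, map_eq⟩ := h.exists_unitary norm_map
  obtain ⟨V, W, hV, hW, map_eq⟩ : ∃ V W : Op m n, IsLocalUnitary V ∧ IsLocalUnitary W ∧
      ∀ x, Φ (legOp x) = V * legOp x * W :=
    ⟨_, _, ⟨U 0, hU 0, U 1, hU 1, Or.inl rfl⟩,
      ⟨(U 2)ᵀ, transpose_mem_unitaryGroup_iff.2 (hU 2), (U 3)ᵀ,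
        transpose_mem_unitaryGroup_iff.2 (hU 3), Or.inl rfl⟩,
      fun x => (map_eq x).trans (kronecker_mul_legOp_mul U x).symm⟩
  have Φ_eq : Φ = LinearMap.mulLeftRight ℂ (V, W) := linearMap_ext_legOp fun x => by
    rw [map_eq, LinearMap.mulLeftRight_apply]
  exact Subsemigroup.subset_closure (Or.inl ⟨V, W, hV, hW, fun X => by
    rw [Φ_eq, LinearMap.mulLeftRight_apply]⟩)

end
end LocalUnitary

section Isometries

open Matrix Equiv
open scoped Matrix.Norms.Frobenius
attribute [local instance] hilbertSchmidt

variable {m n k : ℕ} {Φ : Module.End ℂ (Op m n)}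

section

variable [NeZero m] [NeZero n]

theorem lowRankOp_iff_exists_smul (hk : 1 ≤ k) {X : Op m n} :
    LowRankOp k X ↔ ∃ (c : ℂ), ∃ Y ∈ pureOps m n k, X = c • Y := by
  constructor
  · intro hX
    by_cases hX₀ : X = 0
    · exact ⟨0, _, single_mem_pureOps hk 0 0, by rw [hX₀, zero_smul]⟩
    · have norm_ne_zero : (‖X‖ : ℂ) ≠ 0 := by simpa using hX₀
      exact ⟨‖X‖, (‖X‖ : ℂ)⁻¹ • X, mem_pureOps_iff.2 ⟨hX.smul _, norm_smul_inv_norm hX₀⟩,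
        (smul_inv_smul₀ norm_ne_zero X).symm⟩
  · rintro ⟨c, Y, hY, rfl⟩
    exact (mem_pureOps_iff.1 hY).1.smul c

theorem bijective_of_image_pureOps_eq (hk : 1 ≤ k) (hΦ : Φ '' pureOps m n k = pureOps m n k) :
    Function.Bijective Φ := by
  have surjective : Function.Surjective Φ := by
    rw [← LinearMap.range_eq_top, ← top_le_iff, ← (isAtomSet_pureOps hk).span_eq_top,
      Submodule.span_le, ← hΦ]
    exact Set.image_subset_range _ _
  exact ⟨LinearMap.injective_iff_surjective.2 surjective, surjective⟩

theorem lowRankOp_map_iff (hk : 1 ≤ k) (hΦ : Φ '' pureOps m n k = pureOps m n k) {X : Op m n} :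
    LowRankOp k (Φ X) ↔ LowRankOp k X := by
  have injective := (bijective_of_image_pureOps_eq hk hΦ).1
  rw [lowRankOp_iff_exists_smul hk, lowRankOp_iff_exists_smul hk]
  conv_lhs => rw [← hΦ]
  simp only [Set.exists_mem_image, ← map_smul, injective.eq_iff]

theorem norm_map_of_image_pureOps_eq (hk : 1 ≤ k) (hΦ : Φ '' pureOps m n k = pureOps m n k)
    {X : Op m n} (hX : LowRankOp k X) : ‖Φ X‖ = ‖X‖ := by
  obtain ⟨c, Y, hY, rfl⟩ := (lowRankOp_iff_exists_smul hk).1 hX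
  have map_mem : Φ Y ∈ pureOps m n k := hΦ ▸ Set.mem_image_of_mem Φ hY
  rw [map_smul, norm_smul, norm_smul, (mem_pureOps_iff.1 hY).2, (mem_pureOps_iff.1 map_mem).2]

theorem image_mul_mul_pureOps {G H : Module.End ℂ (Op m n)}
    (hG : G ∈ Subsemigroup.closure (generators m n k))
    (hH : H ∈ Subsemigroup.closure (generators m n k)) (hΦ : Φ '' pureOps m n k = pureOps m n k) :
    (H * (Φ * G)) '' pureOps m n k = pureOps m n k := by
  simp only [Module.End.coe_mul, Set.image_comp, hΦ, image_pureOps_of_mem_closure_generators hG,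
    image_pureOps_of_mem_closure_generators hH]

end

theorem exists_actsAs_of_image_pureOps_eq (hk : 1 ≤ k) (hm : k < m) (hn : k < n)
    (hΦ : Φ '' pureOps m n k = pureOps m n k) : ∃ ρ, ActsAs Φ ρ := by
  have : NeZero m := ⟨hm.ne_bot⟩
  have : NeZero n := ⟨hn.ne_bot⟩
  exact exists_actsAs (hk.trans_lt hm) (hk.trans_lt hn)
    (Φ := LinearEquiv.ofBijective Φ (bijective_of_image_pureOps_eq hk hΦ)) fun _ =>
      lowRankOp_one_map_iff hk (by simpa) (by simpa) ⟨2, two_ne_zero, by norm_num⟩ fun _ =>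
        lowRankOp_map_iff hk hΦ

theorem ActsAs.exists_mul_mul_eq_one (hk : 1 ≤ k) (hm : k < m) (hn : k < n)
    (hΦ : Φ '' pureOps m n k = pureOps m n k) {ρ : Perm (Fin 4)} (hρ : ActsAs Φ ρ) :
    ∃ τ ∈ realizedPerms m n k, ∃ τ' ∈ realizedPerms m n k, τ * ρ * τ' = 1 := by
  have : NeZero m := ⟨hm.ne_bot⟩
  have : NeZero n := ⟨hn.ne_bot⟩
  have : Nontrivial (Fin m) := Fin.nontrivial_iff_two_le.2 (hk.trans_lt hm)
  have : Nontrivial (Fin n) := Fin.nontrivial_iff_two_le.2 (hk.trans_lt hn)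
  obtain ⟨τ, hτ, τ', hτ', mul_mul_mem⟩ := hρ.exists_mul_mul_eq (k := k)
  rcases Finset.mem_insert.1 mul_mul_mem with eq_one | eq_swap
  · exact ⟨τ, hτ, τ', hτ', eq_one⟩
  rw [Finset.mem_singleton] at eq_swap
  obtain rfl | hk₂ := hk.eq_or_lt
  · refine ⟨τ, hτ, τ' * swap 1 3, mul_mem hτ' swap_one_three_mem_realizedPerms, ?_⟩
    rw [← mul_assoc, eq_swap, Equiv.swap_mul_self]
  · obtain ⟨G, hG, hGτ⟩ := hτ
    obtain ⟨H, hH, hHτ'⟩ := hτ'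
    have hΨ := image_mul_mul_pureOps hG hH hΦ
    exact absurd (eq_swap ▸ (hGτ.mul hρ).mul hHτ') (not_actsAs_swap_one_three
      (bijective_of_image_pureOps_eq hk hΨ).1 fun X hX => (lowRankOp_map_iff hk hΨ).2 (hX.mono hk₂))

theorem image_pureOps_eq_iff (hk : 1 ≤ k) (hm : k < m) (hn : k < n) :
    Φ '' pureOps m n k = pureOps m n k ↔ Φ ∈ Subsemigroup.closure (generators m n k) := by
  have : NeZero m := ⟨hm.ne_bot⟩
  have : NeZero n := ⟨hn.ne_bot⟩
  refine ⟨fun hΦ => ?_, image_pureOps_of_mem_closure_generators⟩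
  obtain ⟨ρ, hρ⟩ := exists_actsAs_of_image_pureOps_eq hk hm hn hΦ
  obtain ⟨τ, ⟨G, hG, hGτ⟩, τ', ⟨H, hH, hHτ'⟩, mul_eq⟩ := hρ.exists_mul_mul_eq_one hk hm hn hΦ
  have mem_closure : H * (Φ * G) ∈ Subsemigroup.closure (generators m n k) :=
    ActsAs.mem_closure_generators (mul_eq ▸ (hGτ.mul hρ).mul hHτ') fun x =>
      norm_map_of_image_pureOps_eq hk (image_mul_mul_pureOps hG hH hΦ)
        ((lowRankOp_one_iff.2 ⟨x, rfl⟩).mono hk)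
  have Φ_eq : Φ = star H * (H * (Φ * G)) * star G := by
    rw [← mul_assoc, (mem_unitary_of_mem_closure_generators hH).1, one_mul, mul_assoc,
      (mem_unitary_of_mem_closure_generators hG).2, mul_one]
  rw [Φ_eq]
  exact mul_mem (mul_mem (star_mem_closure_generators hH) mem_closure)
    (star_mem_closure_generators hG)

theorem skNorm_preserving_iff (hk : 1 ≤ k) (hm : k < m) (hn : k < n) :
    (∀ X, skNorm k (Φ X) = skNorm k X) ↔ Φ ∈ Subsemigroup.closure (generators m n k) := by
  have : NeZero m := ⟨hm.ne_bot⟩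
  have : NeZero n := ⟨hn.ne_bot⟩
  simp only [skNorm_eq_supportNorm, (isAtomSet_pureOps hk).supportNorm_preserving_iff,
    image_pureOps_eq_iff hk hm hn]
  exact ⟨fun h => star_star Φ ▸ star_mem_closure_generators h, star_mem_closure_generators⟩

theorem gammaNorm_preserving_iff (hk : 1 ≤ k) (hm : k < m) (hn : k < n) :
    (∀ X, gammaNorm k (Φ X) = gammaNorm k X) ↔ Φ ∈ Subsemigroup.closure (generators m n k) := by
  have : NeZero m := ⟨hm.ne_bot⟩
  have : NeZero n := ⟨hn.ne_bot⟩
  simp only [gammaNorm_eq_atomicNorm, (isAtomSet_pureOps hk).atomicNorm_preserving_iff,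
    image_pureOps_eq_iff hk hm hn]

end Isometries

end EntNorm

end

theorem theorem6p1 (m n k : ℕ) (hk : 1 ≤ k) (hkmn : k < min m n)
    (Φ : EntNorm.Op m n →ₗ[ℂ] EntNorm.Op m n) :
    List.TFAE [
      ∀ X : EntNorm.Op m n, EntNorm.skNorm k (Φ X) = EntNorm.skNorm k X,
      ∀ X : EntNorm.Op m n, EntNorm.gammaNorm k (Φ X) = EntNorm.gammaNorm k X,
      Φ ∈ Subsemigroup.closure (EntNorm.generators m n k)] := by
  obtain ⟨hm, hn⟩ := lt_min_iff.1 hkmn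
  tfae_have 1 ↔ 3 := EntNorm.skNorm_preserving_iff hk hm hn
  tfae_have 2 ↔ 3 := EntNorm.gammaNorm_preserving_iff hk hm hn
  tfae_finish
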